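/- All distances are finite. A \emph{length space} is a metric space in which the distance of any two points is the infimum of the lengths of the curves connecting them. A \emph{geodesic} is an isometric embedding of a compact interval. A \emph{CAT($\kappa$) space} is a complete length space in which any two points (at distance $<\pi/\sqrt\kappa$ if $\kappa>0$) are joined by a geodesic and every geodesic triangle (of perimeter $<2\pi/\sqrt\kappa$ if $\kappa>0$) is not thicker than its comparison triangle in the complete simply connected surface of constant curvature $\kappa$. A subset $B$ of $X$ is \emph{convex in $X$} if any two of its points are joined by a geodesic of $X$ and every such geodesic lies in $B$. A \emph{Jordan curve} in a metric space is a subset homeomorphic to a circle. A metric space $Y$ \emph{majorizes} a rectifiable Jordan curve $\Gamma\subset X$ if there are a $1$-Lipschitz map $P:Y\to X$ and a Jordan curve $\Gamma'\subset Y$ that $P$ sends bijectively and in an arc length preserving way onto $\Gamma$. \textbf{Proposition.} Let $\kappa\in\mathbb R$ and $\Lambda>0$, with $\Lambda\le \pi/\sqrt\kappa$ if $\kappa>0$. Let $X$ be a complete length space such that every Jordan curve $\Gamma$ in $X$ of length $<2\Lambda$ is majorized by some CAT($\kappa$) space $Y_\Gamma$. Then every closed ball $B$ in $X$ of any radius $r<\Lambda/2$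 is convex in $X$ and, with the metric induced from $X$, is CAT($\kappa$). Moreover, if $\kappa>0$ and $\Lambda=\pi/\sqrt\kappa$, then $X$ is CAT($\kappa$). -/

import Mathlib

universe u v

/-- A metric space is a length space if the distance between any two points is the greatest
lower bound of the lengths of the curves that connect them. -/
def IsLengthSpace (X : Type*) [MetricSpace X] : Prop :=
  ∀ x y : X, edist x y = ⨅ γ : Path x y, eVariationOn γ Set.univ

/-- `γ`, restricted to `[0, dist p q]`, is a geodesic (an isometric embedding of an interval)
from `p` to `q`. -/
structure IsGeodesicBetween {X : Type*} [MetricSpace X] (γ : ℝ → X) (p q : X) : Prop where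
  source : γ 0 = p
  target : γ (dist p q) = q
  isometric : ∀ s ∈ Set.Icc 0 (dist p q), ∀ t ∈ Set.Icc 0 (dist p q), dist (γ s) (γ t) = |s - t|

/-- A subset `B` of `X` is convex in `X` if any two points of `B` are joined by a geodesic of `X`
and every such geodesic is contained in `B`. -/
def IsGeodesicallyConvex {X : Type*} [MetricSpace X] (B : Set X) : Prop :=
  ∀ p ∈ B, ∀ q ∈ B, (∃ γ : ℝ → X, IsGeodesicBetween γ p q) ∧
    ∀ γ : ℝ → X, IsGeodesicBetween γ p q → Set.MapsTo γ (Set.Icc 0 (dist p q)) B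

/-- Geodesic triangles in `X` (of perimeter less than `2π/√κ` if `κ > 0`) are not thicker than
their comparison triangles in the model plane `M` with distance function `δ`.

Here `p`, `q`, `r` are the vertices, `γ` and `η` are two sides starting at `p`, and `γ s`, `η t`
are points on them; `p'`, `q'`, `r'` span a comparison triangle. The comparison point `x'` of `γ s`
is the point of the side from `p'` to `q'` at distance `s` from `p'`, which is the only point of the
model plane with the given distances to `p'` and `q'`; likewise for `y'` and `η t`. Since the
vertices are arbitrary, all pairs of points on two sides of the triangle are covered. -/
def TrianglesThin (κ : ℝ) (X : Type*) [MetricSpace X] (M : Type) (δ : M → M → ℝ) : Prop :=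
  ∀ (p q r : X) (γ η : ℝ → X), IsGeodesicBetween γ p q → IsGeodesicBetween η p r →
    (0 < κ → dist p q + dist q r + dist r p < 2 * (Real.pi / √κ)) →
    ∀ s ∈ Set.Icc 0 (dist p q), ∀ t ∈ Set.Icc 0 (dist p r),
    ∀ p' q' r' x' y' : M,
      δ p' q' = dist p q → δ q' r' = dist q r → δ p' r' = dist p r →
      δ p' x' = s → δ x' q' = dist p q - s →
      δ p' y' = t → δ y' r' = dist p r - t →
      dist (γ s) (η t) ≤ δ x' y'

/-- CAT(κ) spaces: complete length spaces in which any two points (at distance less than `π/√κ` if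
`κ > 0`) are joined by a geodesic, and in which geodesic triangles (of perimeter less than `2π/√κ`
if `κ > 0`) are not thicker than comparison triangles in the complete simply connected surface of
constant curvature `κ`: the Euclidean plane, the round 2-sphere with its angular distance divided by
`√κ`, or the hyperbolic plane with its distance divided by `√(-κ)`. -/
structure IsCAT (κ : ℝ) (X : Type*) [MetricSpace X] : Prop where
  complete : CompleteSpace X
  length : IsLengthSpace X
  geodesic : ∀ p q : X, (0 < κ → dist p q < Real.pi / √κ) → ∃ γ : ℝ → X, IsGeodesicBetween γ p q
  thin_zero : κ = 0 → TrianglesThin κ X (EuclideanSpace ℝ (Fin 2)) dist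
  thin_pos : 0 < κ → TrianglesThin κ X (Metric.sphere (0 : EuclideanSpace ℝ (Fin 3)) 1)
    (fun u v => InnerProductGeometry.angle (u : EuclideanSpace ℝ (Fin 3)) v / √κ)
  thin_neg : κ < 0 → TrianglesThin κ X UpperHalfPlane (fun z w => dist z w / √(-κ))

/-- A Jordan curve is a subset homeomorphic to a circle. -/
def IsJordanCurve {X : Type*} [MetricSpace X] (Γ : Set X) : Prop :=
  Nonempty (Circle ≃ₜ Γ)

/-- The length of a Jordan curve, i.e. the length of the closed curve `t ↦ φ (exp (i t))`,
`0 ≤ t ≤ 2π`, for a homeomorphism `φ` from the circle onto it; all `φ` give the same value. -/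
noncomputable def jordanLength {X : Type*} [MetricSpace X] (Γ : Set X) : ENNReal :=
  ⨅ φ : Circle ≃ₜ Γ,
    eVariationOn (fun t : ℝ => (φ (Circle.exp t) : X)) (Set.Icc 0 (2 * Real.pi))

/-- `Y` majorizes `Γ`: a 1-Lipschitz map `P : Y → X` sends some Jordan curve `Γ'` of `Y` bijectively
onto `Γ` and preserves the length of every arc of `Γ'`. -/
def Majorizes (Y : Type*) [MetricSpace Y] {X : Type*} [MetricSpace X] (Γ : Set X) : Prop :=
  ∃ P : Y → X, LipschitzWith 1 P ∧ ∃ Γ' : Set Y, IsJordanCurve Γ' ∧ Set.BijOn P Γ' Γ ∧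
    ∀ (c : ℝ → Y) (a b : ℝ), ContinuousOn c (Set.Icc a b) → Set.InjOn c (Set.Icc a b) →
      Set.MapsTo c (Set.Icc a b) Γ' →
      eVariationOn (P ∘ c) (Set.Icc a b) = eVariationOn c (Set.Icc a b)

/-! All signs of κ are treated at once through a generalized sine S, cosine C and versine v, with C
= 1 - κv. In a model plane, Stewart's theorem gives v of a cevian as an explicit combination of v of
the two adjacent sides and of the parts of the base; `StewartLE` is the inequality version.
Everything reduces to this inequality in X for a vertex q and a geodesic γ, of length and of
distances from q less than Λ (`MajorizedByCAT.stewartLE`). Applied twice, it shows that triangles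
are thin (`trianglesThin_of_stewartLE`); applied once, that balls are convex, because C(r) > 0 for r
< Λ/2.

The inequality is local along γ. It says that h(t) = v(d(q, γ t)) - v(t) satisfies h'' + κh ≥ 0 in a
weak sense, and a maximum principle (`modelSin_convex_of_local`) needs it at each interior b only
for one pair of points of γ around b. If a shortest path to q from a point of γ near γ b runs along
γ through γ b, the triangle inequality suffices (`stewartLE_of_kink`). Otherwise there are a < b < c
such that the triangle q, γ a, γ c is simple, except that its sides from q may share an initial
segment. Without that segment it is a Jordan curve of length < 2Λ. Since the majorizing map P is
1-Lipschitz and preserves arc length, the lift of this curve to the CAT(κ) space is a triangle with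
the same side lengths, and its cevian is at least as long as the one in X. The shared segment is
restored by `stewartLE_of_tail`.

Geodesics have to be constructed first. Two almost shortest injective arcs with common endpoints at
distance < Λ bound simple loops of length < 2Λ. The lifts of these loops lie near a geodesic of the
CAT(κ) space, so the arcs are uniformly close (`MajorizedByCAT.arcs_close`). By completeness, almost
shortest arcs then converge to a geodesic. -/

/-- The generalized sine: the solution of `f'' + κ f = 0`, `f 0 = 0`, `f' 0 = 1`. -/
noncomputable def modelSin (κ t : ℝ) : ℝ :=
  if 0 < κ then Real.sin (√κ * t) / √κ
  else if κ < 0 then Real.sinh (√(-κ) * t) / √(-κ) else t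

/-- The generalized cosine: the derivative of `modelSin κ`. -/
noncomputable def modelCos (κ t : ℝ) : ℝ :=
  if 0 < κ then Real.cos (√κ * t) else if κ < 0 then Real.cosh (√(-κ) * t) else 1

/-- The generalized versine `(1 - modelCos κ t) / κ`, equal to `t ^ 2 / 2` if `κ = 0`. -/
noncomputable def modelVer (κ t : ℝ) : ℝ := 2 * modelSin κ (t / 2) ^ 2

/-- `t` is less than the diameter of the model plane of curvature `κ`. -/
def BelowDiam (κ t : ℝ) : Prop := 0 < κ → t < Real.pi / √κ

/-- `t` is at most the diameter of the model plane of curvature `κ`. -/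
def WithinDiam (κ t : ℝ) : Prop := 0 < κ → t ≤ Real.pi / √κ

/-! ### Trigonometry of constant curvature, Stewart's inequality and a maximum principle -/

section ModelFunctions

variable {κ : ℝ}

theorem BelowDiam.mono {s t : ℝ} (h : BelowDiam κ t) (hst : s ≤ t) : BelowDiam κ s :=
  fun hκ => hst.trans_lt (h hκ)

theorem BelowDiam.within {t : ℝ} (h : BelowDiam κ t) : WithinDiam κ t := fun hκ => (h hκ).le

theorem WithinDiam.below {s t : ℝ} (h : WithinDiam κ t) (hst : s < t) : BelowDiam κ s :=
  fun hκ => hst.trans_le (h hκ)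

theorem modelSin_of_pos (hκ : 0 < κ) (t : ℝ) : modelSin κ t = Real.sin (√κ * t) / √κ := by
  simp [modelSin, hκ]

theorem modelSin_of_neg (hκ : κ < 0) (t : ℝ) :
    modelSin κ t = Real.sinh (√(-κ) * t) / √(-κ) := by
  simp [modelSin, hκ, hκ.le.not_gt]

@[simp] theorem modelSin_zero_left (t : ℝ) : modelSin 0 t = t := by simp [modelSin]

theorem modelCos_of_pos (hκ : 0 < κ) (t : ℝ) : modelCos κ t = Real.cos (√κ * t) := by
  simp [modelCos, hκ]

theorem modelCos_of_neg (hκ : κ < 0) (t : ℝ) : modelCos κ t = Real.cosh (√(-κ) * t) := by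
  simp [modelCos, hκ, hκ.le.not_gt]

@[simp] theorem modelCos_zero_left (t : ℝ) : modelCos 0 t = 1 := by simp [modelCos]

theorem modelSin_zero : modelSin κ 0 = 0 := by
  simp [modelSin]

theorem modelCos_zero : modelCos κ 0 = 1 := by
  simp [modelCos]

theorem modelSin_neg (t : ℝ) : modelSin κ (-t) = -modelSin κ t := by
  unfold modelSin; split_ifs <;> simp [neg_div]

theorem modelCos_neg (t : ℝ) : modelCos κ (-t) = modelCos κ t := by
  unfold modelCos; split_ifs <;> simp

theorem modelSin_add (a b : ℝ) :
    modelSin κ (a + b) = modelSin κ a * modelCos κ b + modelCos κ a * modelSin κ b := by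
  rcases lt_trichotomy κ 0 with h | rfl | h
  · simp only [modelSin_of_neg h, modelCos_of_neg h, mul_add, Real.sinh_add]; ring
  · simp
  · simp only [modelSin_of_pos h, modelCos_of_pos h, mul_add, Real.sin_add]; ring

theorem modelCos_add (a b : ℝ) :
    modelCos κ (a + b) = modelCos κ a * modelCos κ b - κ * modelSin κ a * modelSin κ b := by
  rcases lt_trichotomy κ 0 with h | rfl | h
  · have h0 : √(-κ) ≠ 0 := (Real.sqrt_pos.2 (neg_pos.2 h)).ne'
    have h1 : √(-κ) ^ 2 = -κ := Real.sq_sqrt (neg_pos.2 h).le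
    simp only [modelSin_of_neg h, modelCos_of_neg h, mul_add, Real.cosh_add]
    field_simp
    rw [h1]; ring
  · simp
  · have h0 : √κ ≠ 0 := (Real.sqrt_pos.2 h).ne'
    have h1 : √κ ^ 2 = κ := Real.sq_sqrt h.le
    simp only [modelSin_of_pos h, modelCos_of_pos h, mul_add, Real.cos_add]
    field_simp
    rw [h1]; ring

theorem modelCos_sq_add (t : ℝ) : modelCos κ t ^ 2 + κ * modelSin κ t ^ 2 = 1 := by
  have := modelCos_add (κ := κ) t (-t)
  rw [modelSin_neg, modelCos_neg, add_neg_cancel, modelCos_zero] at this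
  linarith

theorem continuous_modelSin : Continuous (modelSin κ) := by
  unfold modelSin; split_ifs <;> fun_prop

theorem continuous_modelCos : Continuous (modelCos κ) := by
  unfold modelCos; split_ifs <;> fun_prop

theorem continuous_modelVer : Continuous (modelVer κ) := by
  have := continuous_modelSin (κ := κ)
  unfold modelVer; fun_prop

theorem modelVer_zero : modelVer κ 0 = 0 := by simp [modelVer, modelSin_zero]

theorem modelVer_nonneg (t : ℝ) : 0 ≤ modelVer κ t := by unfold modelVer; positivity

theorem modelVer_neg (t : ℝ) : modelVer κ (-t) = modelVer κ t := by
  simp [modelVer, neg_div, modelSin_neg]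

theorem modelVer_abs (t : ℝ) : modelVer κ |t| = modelVer κ t := by
  rcases abs_choice t with h | h <;> simp [h, modelVer_neg]

theorem modelCos_eq (t : ℝ) : modelCos κ t = 1 - κ * modelVer κ t := by
  have h1 := modelCos_add (κ := κ) (t / 2) (t / 2)
  have h2 := modelCos_sq_add (κ := κ) (t / 2)
  rw [add_halves] at h1
  unfold modelVer
  linear_combination h1 + h2

theorem modelSin_sq (t : ℝ) : modelSin κ t ^ 2 = 2 * modelVer κ t - κ * modelVer κ t ^ 2 := by
  have h1 := modelSin_add (κ := κ) (t / 2) (t / 2)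
  have h2 := modelCos_sq_add (κ := κ) (t / 2)
  rw [add_halves] at h1
  unfold modelVer
  rw [h1]
  linear_combination 4 * modelSin κ (t / 2) ^ 2 * h2

theorem modelVer_add (a b : ℝ) :
    modelVer κ (a + b) = modelVer κ a + modelCos κ a * modelVer κ b
      + modelSin κ a * modelSin κ b := by
  have h0 := modelSin_add (κ := κ) (a / 2) (b / 2)
  have h1 := modelSin_add (κ := κ) (a / 2) (a / 2)
  have h2 := modelSin_add (κ := κ) (b / 2) (b / 2)
  have h3 := modelCos_sq_add (κ := κ) (a / 2)
  have h4 := modelCos_sq_add (κ := κ) (b / 2)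
  have h5 := modelCos_add (κ := κ) (a / 2) (a / 2)
  rw [add_halves] at h1 h2 h5
  rw [← add_div] at h0
  unfold modelVer
  rw [h0, h1, h2, h5]
  linear_combination (2 * modelSin κ (a / 2) ^ 2) * h4 

/-- Sum-to-product formula. It yields both the monotonicity of v up to the diameter and the estimate
of its increments. -/
theorem modelVer_sub_modelVer (x y : ℝ) :
    modelVer κ y - modelVer κ x = 2 * modelSin κ ((x + y) / 2) * modelSin κ ((y - x) / 2) := by
  have e1 : (x + y) / 2 = y / 2 + x / 2 := by ring
  have e2 : (y - x) / 2 = y / 2 + -(x / 2) := by ring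
  have h3 := modelCos_sq_add (κ := κ) (x / 2)
  have h4 := modelCos_sq_add (κ := κ) (y / 2)
  rw [e1, e2, modelSin_add, modelSin_add, modelCos_neg, modelSin_neg]
  unfold modelVer
  linear_combination (2 * modelSin κ (x / 2) ^ 2) * h4 - 2 * modelSin κ (y / 2) ^ 2 * h3

theorem modelSin_pos {t : ℝ} (ht : 0 < t) (h : BelowDiam κ t) : 0 < modelSin κ t := by
  rcases lt_trichotomy κ 0 with hκ | rfl | hκ
  · have := Real.sqrt_pos.2 (neg_pos.2 hκ)
    rw [modelSin_of_neg hκ]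
    exact div_pos (Real.sinh_pos_iff.2 (mul_pos this ht)) this
  · simpa
  · have h0 := Real.sqrt_pos.2 hκ
    rw [modelSin_of_pos hκ]
    refine div_pos (Real.sin_pos_of_pos_of_lt_pi (mul_pos h0 ht) ?_) h0
    have := h hκ
    rw [lt_div_iff₀ h0] at this
    linarith

theorem modelSin_nonneg {t : ℝ} (ht : 0 ≤ t) (h : WithinDiam κ t) : 0 ≤ modelSin κ t := by
  rcases lt_trichotomy κ 0 with hκ | rfl | hκ
  · have := Real.sqrt_pos.2 (neg_pos.2 hκ)
    rw [modelSin_of_neg hκ]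
    exact div_nonneg (Real.sinh_nonneg_iff.2 (mul_nonneg this.le ht)) this.le
  · simpa
  · have h0 := Real.sqrt_pos.2 hκ
    rw [modelSin_of_pos hκ]
    refine div_nonneg (Real.sin_nonneg_of_nonneg_of_le_pi (mul_nonneg h0.le ht) ?_) h0.le
    have := h hκ
    rw [le_div_iff₀ h0] at this
    linarith

theorem modelCos_pos {t : ℝ} (h : BelowDiam κ (2 * |t|)) : 0 < modelCos κ t := by
  rcases lt_trichotomy κ 0 with hκ | rfl | hκ
  · rw [modelCos_of_neg hκ]; exact Real.cosh_pos _
  · simp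
  · have h0 := Real.sqrt_pos.2 hκ
    have := h hκ
    rw [lt_div_iff₀ h0] at this
    rw [modelCos_of_pos hκ]
    have h2 : |√κ * t| < Real.pi / 2 := by
      rw [abs_mul, abs_of_pos h0]; linarith
    exact Real.cos_pos_of_mem_Ioo ⟨by linarith [(abs_lt.1 h2).1], (abs_lt.1 h2).2⟩

theorem modelVer_lt {x y : ℝ} (hx : 0 ≤ x) (hxy : x < y) (hy : WithinDiam κ y) :
    modelVer κ x < modelVer κ y := by
  have h := modelVer_sub_modelVer (κ := κ) x y
  have h1 : 0 < modelSin κ ((x + y) / 2) := modelSin_pos (by linarith) (hy.below (by linarith))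
  have h2 : 0 < modelSin κ ((y - x) / 2) := modelSin_pos (by linarith) (hy.below (by linarith))
  have := mul_pos h1 h2
  linarith

theorem modelVer_le {x y : ℝ} (hx : 0 ≤ x) (hxy : x ≤ y) (hy : WithinDiam κ y) :
    modelVer κ x ≤ modelVer κ y := by
  rcases hxy.eq_or_lt with rfl | h
  · rfl
  · exact (modelVer_lt hx h hy).le

theorem le_of_modelVer_le {x y : ℝ} (hy : 0 ≤ y) (hx : WithinDiam κ x)
    (h : modelVer κ x ≤ modelVer κ y) : x ≤ y := by
  by_contra! hlt
  exact absurd (modelVer_lt hy hlt hx) h.not_gt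

/-- In a triangle with sides `a`, `c` and base `s + t`, the cevian `m` from the apex, which divides
the base into parts `s` (adjacent to `a`) and `t`, is at most as long as in the model plane. -/
def StewartLE (κ a c s t m : ℝ) : Prop :=
  modelSin κ (s + t) * modelVer κ m ≤ modelSin κ t * modelVer κ a + modelSin κ s * modelVer κ c
    - modelSin κ s * modelVer κ t - modelSin κ t * modelVer κ s

theorem StewartLE.symm {a c s t m : ℝ} (h : StewartLE κ a c s t m) : StewartLE κ c a t s m := by
  unfold StewartLE at *
  rw [add_comm t s]; linarith

theorem modelSin_add_eq (s t : ℝ) :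
    modelSin κ (s + t) = modelSin κ s + modelSin κ t
      - κ * (modelSin κ s * modelVer κ t + modelSin κ t * modelVer κ s) := by
  rw [modelSin_add, modelCos_eq, modelCos_eq]; ring

/-- Stewart's theorem on a line. -/
theorem modelSin_mul_modelVer_line (a s t : ℝ) :
    modelSin κ (s + t) * modelVer κ (a + s) = modelSin κ t * modelVer κ a
      + modelSin κ s * modelVer κ (a + s + t)
      - modelSin κ s * modelVer κ t - modelSin κ t * modelVer κ s := by
  have hs := modelSin_sq (κ := κ) s
  rw [add_assoc, modelVer_add a (s + t), modelVer_add s t, modelSin_add s t, modelVer_add a s]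
  simp only [modelCos_eq]
  linear_combination (-modelSin κ t * (1 - κ * modelVer κ a)) * hs

/-- If one side of a triangle contains the foot of the cevian on the other side, then the
comparison inequality follows from the triangle inequality. -/
theorem stewartLE_of_kink {s t m c : ℝ} (hs : 0 ≤ s) (hs' : WithinDiam κ s)
    (hc : WithinDiam κ c) (hmc : |m - t| ≤ c) : StewartLE κ (m + s) c s t m := by
  have h := modelSin_mul_modelVer_line (κ := κ) (-(m + s)) s t
  have h1 : modelVer κ (m - t) ≤ modelVer κ c := by
    rw [← modelVer_abs]; exact modelVer_le (abs_nonneg _) hmc hc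
  have h2 := mul_le_mul_of_nonneg_left h1 (modelSin_nonneg hs hs')
  rw [show -(m + s) + s = -m by ring, show -m + t = -(m - t) by ring] at h
  simp only [modelVer_neg] at h
  unfold StewartLE
  linarith

/-- After squaring, the right side exceeds the left by 2 S(s) S(t) (v(s + t) - v(a - c)), which is
nonnegative by the triangle inequality for a, c and the base. This controls the term S(u) in the
expansion of v(e + u) in `stewartLE_of_tail`. -/
theorem modelSin_mul_le_of_stewart {a c s t m : ℝ} (ha : 0 ≤ modelSin κ a)
    (hc : 0 ≤ modelSin κ c) (hs : 0 ≤ modelSin κ s) (ht : 0 ≤ modelSin κ t)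
    (hac : |a - c| ≤ s + t) (hst : WithinDiam κ (s + t))
    (h : modelSin κ (s + t) * modelVer κ m = modelSin κ t * modelVer κ a
      + modelSin κ s * modelVer κ c - modelSin κ s * modelVer κ t - modelSin κ t * modelVer κ s) :
    modelSin κ (s + t) * modelSin κ m ≤ modelSin κ t * modelSin κ a + modelSin κ s * modelSin κ c := by
  refine le_of_abs_le (abs_le_of_sq_le_sq ?_ (by positivity))
  have h1 : modelVer κ (a - c) ≤ modelVer κ (s + t) := by
    rw [← modelVer_abs]; exact modelVer_le (abs_nonneg _) hac hst
  have h2 : 0 ≤ 2 * (modelSin κ t * modelSin κ s) * (modelVer κ (s + t) - modelVer κ (a - c)) :=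
    mul_nonneg (by positivity) (by linarith)
  have e : modelSin κ (s + t) ^ 2 * modelSin κ m ^ 2
      = 2 * modelSin κ (s + t) * (modelSin κ (s + t) * modelVer κ m)
        - κ * (modelSin κ (s + t) * modelVer κ m) ^ 2 := by
    rw [modelSin_sq m]; ring
  rw [sub_eq_add_neg a c, modelVer_add s t, modelVer_add a (-c), modelVer_neg, modelSin_neg,
    modelCos_eq s, modelCos_eq a] at h2
  rw [mul_pow, e, h, modelSin_add_eq]
  have qa := modelSin_sq (κ := κ) a
  have qc := modelSin_sq (κ := κ) c
  have qs := modelSin_sq (κ := κ) s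
  have qt := modelSin_sq (κ := κ) t
  linear_combination h2 - modelSin κ t ^ 2 * qa - modelSin κ s ^ 2 * qc
    + modelSin κ t ^ 2 * qs + modelSin κ s ^ 2 * qt

/-- Attaching a segment of length `e` at the apex of a triangle preserves the comparison
inequality; `u` is the cevian of the comparison triangle. -/
theorem stewartLE_of_tail {e a c s t m u : ℝ} (he : 0 ≤ e) (ha : 0 ≤ a) (hc : 0 ≤ c)
    (hs : 0 ≤ s) (ht : 0 ≤ t) (hm : 0 ≤ m) (hmu : m ≤ e + u) (hac : |a - c| ≤ s + t)
    (hea : WithinDiam κ (e + a)) (hec : WithinDiam κ (e + c)) (heu : WithinDiam κ (e + u))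
    (hst : WithinDiam κ (s + t))
    (h : modelSin κ (s + t) * modelVer κ u = modelSin κ t * modelVer κ a
      + modelSin κ s * modelVer κ c - modelSin κ s * modelVer κ t - modelSin κ t * modelVer κ s) :
    StewartLE κ (e + a) (e + c) s t m := by
  have within : ∀ {x y : ℝ}, WithinDiam κ y → x ≤ y → WithinDiam κ x :=
    fun h hxy hκ => hxy.trans (h hκ)
  have h1 := modelVer_le hm hmu heu
  have hS : 0 ≤ modelSin κ (s + t) := modelSin_nonneg (by linarith) hst
  have h2 := mul_le_mul_of_nonneg_left h1 hS
  have h3 := modelSin_mul_le_of_stewart (modelSin_nonneg ha (within hea (by linarith)))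
    (modelSin_nonneg hc (within hec (by linarith))) (modelSin_nonneg hs (within hst (by linarith)))
    (modelSin_nonneg ht (within hst (by linarith))) hac hst h
  have h4 := mul_le_mul_of_nonneg_left h3 (modelSin_nonneg he (within hea (by linarith)))
  have h5 := modelSin_add_eq (κ := κ) s t
  unfold StewartLE
  rw [modelVer_add e u] at h2
  rw [modelVer_add e a, modelVer_add e c]
  rw [modelCos_eq e] at *
  -- The coefficient C(e) = 1 - κ v(e) of `h` can be negative when κ > 0, so Stewart's theorem is
  -- needed as an equality here.
  linear_combination h2 + h4 + (1 - κ * modelVer κ e) * h + modelVer κ e * h5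

/-- With x and y half the sum and half the difference of s and t, the quotient of the two sines' sum
by S(s + t) is C(y)/C(x). It is at most 1 for κ ≤ 0, and at most 1/C(L/2) for κ > 0. -/
theorem exists_modelSin_add_modelSin_le {L : ℝ} (hL : BelowDiam κ L) :
    ∃ C, 0 < C ∧ ∀ s t, 0 ≤ s → 0 ≤ t → s + t ≤ L →
      modelSin κ s + modelSin κ t ≤ C * modelSin κ (s + t) := by
  refine ⟨max 1 (1 / modelCos κ (L / 2)), by positivity, fun s t hs ht hst => ?_⟩
  set x := (s + t) / 2 with hx
  set y := (s - t) / 2 with hy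
  have hx0 : 0 ≤ x := by positivity
  have e1 : s = x + y := by rw [hx, hy]; ring
  have e2 : t = x + -y := by rw [hx, hy]; ring
  have e3 : s + t = x + x := by rw [hx]; ring
  have hyx : |y| ≤ x := by rw [abs_le]; constructor <;> linarith
  have sx : 0 ≤ modelSin κ x := modelSin_nonneg hx0 (hL.mono (by linarith)).within
  have vy : modelVer κ y ≤ modelVer κ x := by
    rw [← modelVer_abs]; exact modelVer_le (abs_nonneg _) hyx (hL.mono (by linarith)).within
  have vx : modelVer κ x ≤ modelVer κ (L / 2) :=
    modelVer_le hx0 (by linarith) (hL.mono (by linarith)).within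
  have cx : 0 < modelCos κ x := modelCos_pos (hL.mono (by rw [abs_of_nonneg hx0]; linarith))
  have cL : 0 < modelCos κ (L / 2) :=
    modelCos_pos (hL.mono (by rw [abs_of_nonneg (by linarith)]; linarith))
  have key : modelCos κ y ≤ max 1 (1 / modelCos κ (L / 2)) * modelCos κ x := by
    rcases le_or_gt κ 0 with h | h
    · calc modelCos κ y ≤ 1 * modelCos κ x := by
            rw [modelCos_eq y, modelCos_eq x]; nlinarith
        _ ≤ _ := mul_le_mul_of_nonneg_right (le_max_left _ _) cx.le
    · calc modelCos κ y ≤ 1 := by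
            rw [modelCos_eq y]; nlinarith [modelVer_nonneg (κ := κ) y]
        _ = 1 / modelCos κ (L / 2) * modelCos κ (L / 2) := by field_simp
        _ ≤ 1 / modelCos κ (L / 2) * modelCos κ x := by
            refine mul_le_mul_of_nonneg_left ?_ (by positivity)
            rw [modelCos_eq x, modelCos_eq (L / 2)]; nlinarith
        _ ≤ _ := mul_le_mul_of_nonneg_right (le_max_right _ _) cx.le
  rw [e3, modelSin_add x x, e1, e2, modelSin_add, modelSin_add, modelSin_neg, modelCos_neg]
  nlinarith

theorem modelSin_mul_modelSin_three (x s t : ℝ) :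
    modelSin κ (s + t) * modelSin κ (x + s) = modelSin κ t * modelSin κ x
      + modelSin κ s * modelSin κ (x + s + t) := by
  have h := modelCos_sq_add (κ := κ) s
  rw [add_assoc]
  simp only [modelSin_add, modelCos_add]
  linear_combination (modelSin κ x * modelSin κ t) * h

theorem modelSin_mul_modelCos_three (x s t : ℝ) :
    modelSin κ (s + t) * modelCos κ (x + s) = modelSin κ t * modelCos κ x
      + modelSin κ s * modelCos κ (x + s + t) := by
  have h := modelCos_sq_add (κ := κ) s
  rw [add_assoc]
  simp only [modelSin_add, modelCos_add]
  linear_combination (modelCos κ x * modelSin κ t) * h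

/-- Local to global principle for solutions of `h'' + κ h ≥ 0`. -/
theorem modelSin_convex_of_local {L : ℝ} (hL : 0 < L) (hLd : BelowDiam κ L) {h : ℝ → ℝ}
    (hcont : ContinuousOn h (Set.Icc 0 L))
    (hloc : ∀ b ∈ Set.Ioo 0 L, ∃ s t, 0 < s ∧ 0 < t ∧ 0 ≤ b - s ∧ b + t ≤ L ∧
      modelSin κ (s + t) * h b ≤ modelSin κ t * h (b - s) + modelSin κ s * h (b + t))
    {b : ℝ} (hb : b ∈ Set.Icc 0 L) :
    modelSin κ L * h b ≤ modelSin κ (L - b) * h 0 + modelSin κ b * h L := by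
  have sL : 0 < modelSin κ L := modelSin_pos hL hLd
  -- Up to the factor S(L), `u` is h minus the solution of the equation with the same boundary
  -- values. `ψ` is a solution that is positive on [0, L], as L is below the diameter, so a maximum
  -- principle holds for u/ψ.
  set u : ℝ → ℝ := fun t => modelSin κ L * h t - modelSin κ (L - t) * h 0 - modelSin κ t * h L
    with hu
  set ψ : ℝ → ℝ := fun t => modelCos κ (t - L / 2) with hψ
  have ψpos : ∀ t ∈ Set.Icc 0 L, 0 < ψ t := by
    intro t ht
    refine modelCos_pos (hLd.mono ?_)
    have : |t - L / 2| ≤ L / 2 := abs_le.2 ⟨by linarith [ht.1], by linarith [ht.2]⟩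
    linarith
  have cs := continuous_modelSin (κ := κ)
  have cc := continuous_modelCos (κ := κ)
  have wcont : ContinuousOn (fun t => u t / ψ t) (Set.Icc 0 L) := by
    refine ContinuousOn.div ?_ (by fun_prop) fun t ht => (ψpos t ht).ne'
    fun_prop
  obtain ⟨b₁, hb₁, hmax⟩ := isCompact_Icc.exists_isMaxOn (Set.nonempty_Icc.2 hL.le) wcont
  set W := u b₁ / ψ b₁ with hW
  have hle : ∀ t ∈ Set.Icc 0 L, u t ≤ W * ψ t := fun t ht => by
    have := hmax ht
    simp only [Set.mem_ofPred_eq] at this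
    rwa [div_le_iff₀ (ψpos t ht)] at this
  suffices hW0 : W ≤ 0 by
    have h1 := hle b hb
    have h2 := mul_nonpos_of_nonpos_of_nonneg hW0 (ψpos b hb).le
    simp only [hu] at h1
    linarith
  by_contra! hW0
  have hcl := wcont.preimage_isClosed_of_isClosed isClosed_Icc (isClosed_singleton (x := W))
  -- At the first maximum point the bound u ≤ Wψ is strict at b₀ - s. This contradicts the local
  -- inequality, in which ψ gives equality.
  obtain ⟨b₀, ⟨hb₀, hb₀W⟩, hleast⟩ :=
    (isCompact_Icc.of_isClosed_subset hcl Set.inter_subset_left).exists_isLeast ⟨b₁, hb₁, rfl⟩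
  have ub₀ : u b₀ = W * ψ b₀ := by
    rw [← (hb₀W : u b₀ / ψ b₀ = W)]; field_simp [(ψpos b₀ hb₀).ne']
  have upos : 0 < u b₀ := ub₀ ▸ mul_pos hW0 (ψpos b₀ hb₀)
  have u0 : u 0 = 0 := by simp [hu, modelSin_zero]
  have uL : u L = 0 := by simp [hu, modelSin_zero]
  have hb0 : 0 < b₀ := hb₀.1.lt_of_ne (by rintro rfl; exact upos.ne' u0)
  have hbL : b₀ < L := hb₀.2.lt_of_ne (by rintro rfl; exact upos.ne' uL)
  obtain ⟨s, t, hs, ht, hbs, hbt, hh⟩ := hloc b₀ ⟨hb0, hbL⟩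
  have ma : b₀ - s ∈ Set.Icc 0 L := ⟨hbs, by linarith⟩
  have mc : b₀ + t ∈ Set.Icc 0 L := ⟨by linarith, hbt⟩
  have ua : u (b₀ - s) < W * ψ (b₀ - s) := by
    refine (hle _ ma).lt_of_ne fun he => ?_
    have : b₀ ≤ b₀ - s := hleast ⟨ma, by
      change u (b₀ - s) / ψ (b₀ - s) = W
      rw [he]; field_simp [(ψpos _ ma).ne']⟩
    linarith
  have uc := hle _ mc
  have ss : 0 < modelSin κ s := modelSin_pos hs (hLd.mono (by linarith))
  have st : 0 < modelSin κ t := modelSin_pos ht (hLd.mono (by linarith))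
  have i1 := modelSin_mul_modelCos_three (κ := κ) (b₀ - s - L / 2) s t
  have i2 := modelSin_mul_modelSin_three (κ := κ) (b₀ - s) s t
  have i3 := modelSin_mul_modelSin_three (κ := κ) (b₀ - s - L) s t
  rw [show b₀ - s - L / 2 + s = b₀ - L / 2 by ring,
    show b₀ - L / 2 + t = b₀ + t - L / 2 by ring] at i1
  rw [sub_add_cancel] at i2
  rw [show b₀ - s - L + s = -(L - b₀) by ring, show b₀ - s - L = -(L - (b₀ - s)) by ring,
    show -(L - b₀) + t = -(L - (b₀ + t)) by ring] at i3
  simp only [modelSin_neg] at i3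
  have hu3 : modelSin κ (s + t) * u b₀ ≤ modelSin κ t * u (b₀ - s) + modelSin κ s * u (b₀ + t) := by
    simp only [hu]
    linear_combination modelSin κ L * hh + h 0 * i3 - h L * i2
  have j1 := mul_lt_mul_of_pos_left ua st
  have j2 := mul_le_mul_of_nonneg_left uc ss.le
  have j3 : modelSin κ (s + t) * ψ b₀ = modelSin κ t * ψ (b₀ - s) + modelSin κ s * ψ (b₀ + t) := by
    simp only [hψ]; rw [i1]
  rw [ub₀] at hu3
  linarith [congrArg (W * ·) j3]

end ModelFunctions

/-! ### Model planes: Stewart's theorem and existence of comparison triangles -/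

/-- `M` with the distance function `δ` is a model plane of curvature `κ`. -/
structure IsModelPlane (κ : ℝ) (M : Type) (δ : M → M → ℝ) : Prop where
  nonneg : ∀ p q, 0 ≤ δ p q
  self : ∀ p, δ p p = 0
  symm : ∀ p q, δ p q = δ q p
  triangle : ∀ p q r, δ p r ≤ δ p q + δ q r
  within : ∀ p q, WithinDiam κ (δ p q)
  stewart : ∀ p q r x s t, δ p x = s → δ x q = t → δ p q = s + t →
    modelSin κ (s + t) * modelVer κ (δ r x) = modelSin κ t * modelVer κ (δ r p)
      + modelSin κ s * modelVer κ (δ r q)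
      - modelSin κ s * modelVer κ t - modelSin κ t * modelVer κ s
  exists_triangle : ∀ a c s t, 0 ≤ a → 0 ≤ c → 0 ≤ s → 0 ≤ t → |a - (s + t)| ≤ c →
    c ≤ a + (s + t) → (0 < κ → a + c + (s + t) < 2 * (Real.pi / √κ)) →
    ∃ p q r x, δ p q = s + t ∧ δ p x = s ∧ δ x q = t ∧ δ p r = a ∧ δ q r = c

section ModelPlanes

variable {κ : ℝ}

theorem modelVer_zero_left (t : ℝ) : modelVer 0 t = t ^ 2 / 2 := by
  simp only [modelVer, modelSin_zero_left]; ring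

/-- The law of cosines defines an angle for any admissible triple of side lengths. -/
theorem exists_cos_of_sides {a c l : ℝ} (hc : 0 ≤ c)
    (h1 : |a - l| ≤ c) (h2 : c ≤ a + l) (hp : 0 < κ → a + c + l < 2 * (Real.pi / √κ)) :
    ∃ k, k ^ 2 ≤ 1 ∧
      modelVer κ c = modelVer κ (a - l) + modelSin κ a * modelSin κ l * (1 - k) := by
  have hal := abs_le.1 h1
  have lo : modelVer κ (a - l) ≤ modelVer κ c := by
    rw [← modelVer_abs]
    exact modelVer_le (abs_nonneg _) h1 fun hκ => by have := hp hκ; linarith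
  have hsum : modelVer κ (a + l) = modelVer κ (a - l) + 2 * (modelSin κ a * modelSin κ l) := by
    rw [sub_eq_add_neg, modelVer_add, modelVer_add, modelVer_neg, modelSin_neg]; ring
  have hi : modelVer κ c ≤ modelVer κ (a + l) := by
    by_cases hw : WithinDiam κ (a + l)
    · exact modelVer_le hc h2 hw
    -- Beyond the diameter v is no longer increasing. It is symmetric about the diameter, so a + l
    -- can be replaced by 2π/√κ - (a + l), and the perimeter bound says that this exceeds c.
    · have hκ : 0 < κ := by
        by_contra h; exact hw fun h' => absurd h' h
      have hw' : Real.pi / √κ < a + l := by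
        by_contra h; exact hw fun _ => not_lt.1 h
      have hp' := hp hκ
      have h0 := Real.sqrt_pos.2 hκ
      have e : modelVer κ (2 * (Real.pi / √κ) - (a + l)) = modelVer κ (a + l) := by
        unfold modelVer
        rw [modelSin_of_pos hκ, modelSin_of_pos hκ,
          show √κ * ((2 * (Real.pi / √κ) - (a + l)) / 2) = Real.pi - √κ * ((a + l) / 2) by
            field_simp, Real.sin_pi_sub]
      rw [← e]
      exact modelVer_le hc (by linarith) fun _ => by linarith
  have hprod : 0 ≤ modelSin κ a * modelSin κ l := by linarith
  rcases hprod.eq_or_lt with h | h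
  -- If the product of sines vanishes, the lower and upper bounds for v(c) coincide and any k would
  -- do.
  · exact ⟨1, by norm_num, by linarith⟩
  · refine ⟨1 - (modelVer κ c - modelVer κ (a - l)) / (modelSin κ a * modelSin κ l), ?_, ?_⟩
    · have x0 : 0 ≤ (modelVer κ c - modelVer κ (a - l)) / (modelSin κ a * modelSin κ l) :=
        div_nonneg (by linarith) hprod
      have x2 : (modelVer κ c - modelVer κ (a - l)) / (modelSin κ a * modelSin κ l) ≤ 2 := by
        rw [div_le_iff₀ h]; linarith
      nlinarith
    · rw [sub_sub_cancel, mul_div_cancel₀ _ h.ne']; ring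

theorem modelCos_of_sides {a c l k : ℝ}
    (h : modelVer κ c = modelVer κ (a - l) + modelSin κ a * modelSin κ l * (1 - k)) :
    modelCos κ c = modelCos κ a * modelCos κ l + κ * modelSin κ a * modelSin κ l * k := by
  have := modelCos_add (κ := κ) a (-l)
  rw [modelSin_neg, modelCos_neg, ← sub_eq_add_neg, modelCos_eq (a - l)] at this
  rw [modelCos_eq c, h]; linear_combination this

/-- The left side is the squared length of S(s + t) x - S(t) p - S(s) q for unit vectors x, p, q (on
the sphere or the hyperboloid) with products C(s), C(t), C(s + t). It is used to show that a point
between p and q is the expected linear combination of them. -/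
theorem modelSin_gram (s t : ℝ) :
    modelSin κ (s + t) ^ 2 + modelSin κ t ^ 2 + modelSin κ s ^ 2
      - 2 * modelSin κ (s + t) * modelSin κ t * modelCos κ s
      - 2 * modelSin κ (s + t) * modelSin κ s * modelCos κ t
      + 2 * modelSin κ t * modelSin κ s * modelCos κ (s + t) = 0 := by
  have hs := modelCos_sq_add (κ := κ) s
  have ht := modelCos_sq_add (κ := κ) t
  rw [modelSin_add, modelCos_add]
  linear_combination (-modelSin κ t ^ 2) * hs - modelSin κ s ^ 2 * ht

/-- In curved planes Stewart's theorem is linear in C of the distances; substituting C = 1 - κv and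
dividing by κ gives the form that also makes sense for κ = 0. -/
theorem stewart_of_modelCos (hκ : κ ≠ 0) {a c s t m : ℝ}
    (h : modelSin κ (s + t) * modelCos κ m
      = modelSin κ t * modelCos κ a + modelSin κ s * modelCos κ c) :
    modelSin κ (s + t) * modelVer κ m = modelSin κ t * modelVer κ a
      + modelSin κ s * modelVer κ c - modelSin κ s * modelVer κ t - modelSin κ t * modelVer κ s := by
  have e := modelSin_add_eq (κ := κ) s t
  rw [modelCos_eq m, modelCos_eq a, modelCos_eq c] at h
  apply mul_left_cancel₀ hκ
  linear_combination e - h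

theorem isModelPlane_euclidean : IsModelPlane 0 (EuclideanSpace ℝ (Fin 2)) dist where
  nonneg _ _ := dist_nonneg
  self := dist_self
  symm := dist_comm
  triangle := dist_triangle
  within _ _ h := absurd h (lt_irrefl 0)
  stewart p q r x s t h1 h2 h3 := by
    simp only [modelSin_zero_left, modelVer_zero_left, dist_eq_norm] at *
    have e1 : ‖p - q‖ ^ 2 = s ^ 2 + 2 * inner ℝ (p - x) (x - q) + t ^ 2 := by
      rw [← h1, ← h2, ← norm_add_sq_real]; congr 2; abel
    have e2 : inner ℝ (p - x) (x - q) = s * t := by rw [h3] at e1; linarith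
    have e3 : t • (p - x) - s • (x - q) = 0 := by
      rw [← norm_eq_zero, ← sq_eq_zero_iff, norm_sub_sq_real, norm_smul, norm_smul, h1, h2,
        inner_smul_left, inner_smul_right, e2, Real.norm_eq_abs, Real.norm_eq_abs]
      simp only [mul_pow, sq_abs, conj_trivial]; ring
    have e4 : t * inner ℝ (r - x) (p - x) - s * inner ℝ (r - x) (x - q) = 0 := by
      rw [← inner_smul_right, ← inner_smul_right, ← inner_sub_right, e3, inner_zero_right]
    have e5 : ‖r - p‖ ^ 2 = ‖r - x‖ ^ 2 - 2 * inner ℝ (r - x) (p - x) + s ^ 2 := by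
      rw [← h1, ← norm_sub_sq_real]; congr 2; abel
    have e6 : ‖r - q‖ ^ 2 = ‖r - x‖ ^ 2 + 2 * inner ℝ (r - x) (x - q) + t ^ 2 := by
      rw [← h2, ← norm_add_sq_real]; congr 2; abel
    rw [e5, e6]; linear_combination e4
  exists_triangle a c s t ha hc hs ht h1 h2 hp := by
    obtain ⟨k, hk, h⟩ := exists_cos_of_sides hc h1 h2 hp
    simp only [modelSin_zero_left, modelVer_zero_left] at h
    have hk' : √(1 - k ^ 2) ^ 2 = 1 - k ^ 2 := Real.sq_sqrt (by linarith)
    refine ⟨!₂[0, 0], !₂[s + t, 0], !₂[a * k, a * √(1 - k ^ 2)], !₂[s, 0], ?_⟩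
    simp only [EuclideanSpace.dist_eq, Fin.sum_univ_two, Real.dist_eq, sq_abs]
    refine ⟨(congrArg Real.sqrt ?_).trans (Real.sqrt_sq (add_nonneg hs ht)),
      (congrArg Real.sqrt ?_).trans (Real.sqrt_sq hs),
      (congrArg Real.sqrt ?_).trans (Real.sqrt_sq ht),
      (congrArg Real.sqrt ?_).trans (Real.sqrt_sq ha),
      (congrArg Real.sqrt ?_).trans (Real.sqrt_sq hc)⟩ <;>
    simp
    · ring
    · linear_combination a ^ 2 * hk'
    · linear_combination a ^ 2 * hk' - 2 * h

theorem isModelPlane_sphere (hκ : 0 < κ) :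
    IsModelPlane κ (Metric.sphere (0 : EuclideanSpace ℝ (Fin 3)) 1)
      (fun u v => InnerProductGeometry.angle (u : EuclideanSpace ℝ (Fin 3)) v / √κ) := by
  have h0 := Real.sqrt_pos.2 hκ
  have nrm : ∀ u : Metric.sphere (0 : EuclideanSpace ℝ (Fin 3)) 1,
      ‖(u : EuclideanSpace ℝ (Fin 3))‖ = 1 := fun u => by simp
  have hcos : ∀ u v : Metric.sphere (0 : EuclideanSpace ℝ (Fin 3)) 1,
      modelCos κ (InnerProductGeometry.angle (u : EuclideanSpace ℝ (Fin 3)) v / √κ)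
        = inner ℝ (u : EuclideanSpace ℝ (Fin 3)) v := fun u v => by
    rw [modelCos_of_pos hκ, mul_div_cancel₀ _ h0.ne', InnerProductGeometry.cos_angle, nrm, nrm]
    simp
  have hdist : ∀ (u v : Metric.sphere (0 : EuclideanSpace ℝ (Fin 3)) 1) (l : ℝ), 0 ≤ l →
      WithinDiam κ l → inner ℝ (u : EuclideanSpace ℝ (Fin 3)) v = modelCos κ l →
      InnerProductGeometry.angle (u : EuclideanSpace ℝ (Fin 3)) v / √κ = l := by
    intro u v l hl hw h
    have := hw hκ
    rw [le_div_iff₀ h0] at this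
    rw [InnerProductGeometry.angle, nrm, nrm, h, modelCos_of_pos hκ, mul_one, div_one,
      Real.arccos_cos (by positivity) (by linarith)]
    field_simp
  constructor
  · exact fun p q => div_nonneg (InnerProductGeometry.angle_nonneg _ _) h0.le
  · intro p
    have : (p : EuclideanSpace ℝ (Fin 3)) ≠ 0 := fun h => by simpa [h] using nrm p
    rw [InnerProductGeometry.angle_self this, zero_div]
  · exact fun p q => by rw [InnerProductGeometry.angle_comm]
  · intro p q r
    rw [← add_div]
    gcongr
    exact InnerProductGeometry.angle_le_angle_add_angle _ _ _
  · intro p q _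
    gcongr
    exact InnerProductGeometry.angle_le_pi _ _
  · intro p q r x s t h1 h2 h3
    apply stewart_of_modelCos hκ.ne'
    have i1 := hcos p x
    have i2 := hcos x q
    have i3 := hcos p q
    have i4 := hcos r x
    have i5 := hcos r p
    have i6 := hcos r q
    rw [h1] at i1
    rw [h2] at i2
    rw [h3] at i3
    rw [i4, i5, i6]
    have gram := modelSin_gram (κ := κ) s t
    have hv : modelSin κ (s + t) • (x : EuclideanSpace ℝ (Fin 3)) - modelSin κ t • (p : _)
        - modelSin κ s • (q : _) = 0 := by
      rw [← norm_eq_zero, ← sq_eq_zero_iff, norm_sub_sq_real, norm_sub_sq_real, inner_sub_left]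
      simp only [inner_smul_left, inner_smul_right, norm_smul, nrm, conj_trivial, mul_one,
        Real.norm_eq_abs, sq_abs]
      rw [real_inner_comm (p : EuclideanSpace ℝ (Fin 3)) x, ← i1, ← i2, ← i3]
      linear_combination gram
    have := congrArg (inner ℝ (r : EuclideanSpace ℝ (Fin 3))) hv
    simp only [inner_sub_right, inner_smul_right, inner_zero_right] at this
    linear_combination this
  · intro a c s t ha hc hs ht h1 h2 hp
    obtain ⟨k, hk, h⟩ := exists_cos_of_sides hc h1 h2 hp
    have hlc := modelCos_of_sides h
    have hk' : √(1 - k ^ 2) ^ 2 = 1 - k ^ 2 := Real.sq_sqrt (by linarith)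
    have hal := abs_le.1 h1
    have hp' := hp hκ
    have sq := Real.sq_sqrt hκ.le
    have unit : ∀ x y z : ℝ, x ^ 2 + y ^ 2 + z ^ 2 = 1 →
        !₂[x, y, z] ∈ Metric.sphere (0 : EuclideanSpace ℝ (Fin 3)) 1 := by
      intro x y z h
      rw [mem_sphere_zero_iff_norm, EuclideanSpace.norm_eq, Real.sqrt_eq_one]
      simpa [Fin.sum_univ_three] using h
    have unit' : ∀ l : ℝ, modelCos κ l ^ 2 + (√κ * modelSin κ l) ^ 2 + 0 ^ 2 = 1 := fun l => by
      rw [mul_pow, sq, ← modelCos_sq_add (κ := κ) l]; ring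
    refine ⟨⟨_, unit _ _ _ (unit' 0)⟩, ⟨_, unit _ _ _ (unit' (s + t))⟩,
      ⟨_, unit (modelCos κ a) (√κ * modelSin κ a * k) (√κ * modelSin κ a * √(1 - k ^ 2)) ?_⟩,
      ⟨_, unit _ _ _ (unit' s)⟩, hdist _ _ _ (add_nonneg hs ht) ?_ ?_, hdist _ _ _ hs ?_ ?_,
      hdist _ _ _ ht ?_ ?_, hdist _ _ _ ha ?_ ?_, hdist _ _ _ hc ?_ ?_⟩
    · linear_combination (√κ * modelSin κ a) ^ 2 * hk' + modelSin κ a ^ 2 * sq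
        + modelCos_sq_add (κ := κ) a
    · exact fun _ => by linarith
    · simp [Fin.sum_univ_three, PiLp.inner_apply, modelSin_zero, modelCos_zero]
    · exact fun _ => by linarith
    · simp [Fin.sum_univ_three, PiLp.inner_apply, modelSin_zero, modelCos_zero]
    · exact fun _ => by linarith
    · simp only [PiLp.inner_apply, Fin.sum_univ_three]
      simp
      have := modelCos_add (κ := κ) (s + t) (-s)
      rw [modelCos_neg, modelSin_neg, add_neg_cancel_comm] at this
      linear_combination -this + modelSin κ (s + t) * modelSin κ s * sq
    · exact fun _ => by linarith
    · simp [Fin.sum_univ_three, PiLp.inner_apply, modelSin_zero, modelCos_zero]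
    · exact fun _ => by linarith
    · simp only [PiLp.inner_apply, Fin.sum_univ_three]
      simp
      linear_combination -hlc + modelSin κ (s + t) * modelSin κ a * k * sq

/-- The point of the upper half plane with given coordinates on the hyperboloid. -/
noncomputable def UpperHalfPlane.ofHyperboloid (x y z : ℝ) (h : z < x) : UpperHalfPlane :=
  ⟨⟨y / (x - z), 1 / (x - z)⟩, by have : 0 < x - z := sub_pos.2 h; positivity⟩

theorem UpperHalfPlane.cosh_dist_ofHyperboloid {x y z x' y' z' : ℝ} (h : z < x) (h' : z' < x')
    (e : x ^ 2 = 1 + y ^ 2 + z ^ 2) (e' : x' ^ 2 = 1 + y' ^ 2 + z' ^ 2) :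
    Real.cosh (dist (ofHyperboloid x y z h) (ofHyperboloid x' y' z' h'))
      = x * x' - y * y' - z * z' := by
  have : x - z ≠ 0 := (sub_pos.2 h).ne'
  have : x' - z' ≠ 0 := (sub_pos.2 h').ne'
  rw [cosh_dist']
  simp only [ofHyperboloid, UpperHalfPlane.re, UpperHalfPlane.im]
  field_simp
  linear_combination -(x' - z') ^ 2 * e - (x - z) ^ 2 * e'

/-- In Minkowski space the orthogonal complement of a timelike vector is definite. On the
hyperboloid the Gram identity only shows that a vector is null; orthogonality to x then makes it
zero. -/
theorem eq_zero_of_null_of_orthogonal {x₀ x₁ x₂ v₀ v₁ v₂ : ℝ} (hx : x₀ ^ 2 = 1 + x₁ ^ 2 + x₂ ^ 2)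
    (ho : v₀ * x₀ = v₁ * x₁ + v₂ * x₂) (hn : v₀ ^ 2 = v₁ ^ 2 + v₂ ^ 2) :
    v₀ = 0 ∧ v₁ = 0 ∧ v₂ = 0 := by
  have e : v₀ ^ 2 + (v₁ * x₂ - v₂ * x₁) ^ 2 = 0 := by
    linear_combination (v₀ * x₀ + v₁ * x₁ + v₂ * x₂) * ho - v₀ ^ 2 * hx
      - (x₁ ^ 2 + x₂ ^ 2) * hn
  have h0 : v₀ = 0 := by nlinarith [sq_nonneg v₀, sq_nonneg (v₁ * x₂ - v₂ * x₁)]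
  rw [h0] at hn
  refine ⟨h0, ?_, ?_⟩ <;> nlinarith [sq_nonneg v₁, sq_nonneg v₂]

theorem isModelPlane_upperHalfPlane (hκ : κ < 0) :
    IsModelPlane κ UpperHalfPlane (fun z w => dist z w / √(-κ)) := by
  have h0 := Real.sqrt_pos.2 (neg_pos.2 hκ)
  have hcos : ∀ z w : UpperHalfPlane, modelCos κ (dist z w / √(-κ))
      = ((z.re - w.re) ^ 2 + z.im ^ 2 + w.im ^ 2) / (2 * z.im * w.im) := fun z w => by
    rw [modelCos_of_neg hκ, mul_div_cancel₀ _ h0.ne', UpperHalfPlane.cosh_dist']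
  have hdist : ∀ (z w : UpperHalfPlane) (l : ℝ), 0 ≤ l → Real.cosh (dist z w) = modelCos κ l →
      dist z w / √(-κ) = l := by
    intro z w l hl h
    rw [modelCos_of_neg hκ] at h
    rw [Real.cosh_strictMonoOn.injOn (Set.mem_Ici.2 dist_nonneg)
      (Set.mem_Ici.2 (by positivity)) h]
    field_simp
  constructor
  · exact fun p q => div_nonneg dist_nonneg h0.le
  · exact fun p => by rw [dist_self, zero_div]
  · exact fun p q => by rw [dist_comm]
  · intro p q r
    rw [← add_div]
    gcongr
    exact dist_triangle _ _ _
  · exact fun p q h => absurd h hκ.not_gt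
  · intro p q r x s t h1 h2 h3
    apply stewart_of_modelCos hκ.ne
    -- Hyperboloid coordinates of a point of the half plane: the hyperbolic cosine of the distance
    -- becomes the Minkowski product.
    set H₀ : UpperHalfPlane → ℝ := fun z => (z.re ^ 2 + z.im ^ 2 + 1) / (2 * z.im) with hH₀
    set H₁ : UpperHalfPlane → ℝ := fun z => z.re / z.im with hH₁
    set H₂ : UpperHalfPlane → ℝ := fun z => (z.re ^ 2 + z.im ^ 2 - 1) / (2 * z.im) with hH₂
    have hB : ∀ z w, modelCos κ (dist z w / √(-κ)) = H₀ z * H₀ w - H₁ z * H₁ w - H₂ z * H₂ w := by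
      intro z w
      have := z.im_ne_zero
      have := w.im_ne_zero
      rw [hcos, hH₀, hH₁, hH₂]
      field_simp
      ring
    have hx : H₀ x ^ 2 = 1 + H₁ x ^ 2 + H₂ x ^ 2 := by
      have := hB x x
      rw [dist_self, zero_div, modelCos_zero] at this
      linarith
    have hp := hB p p
    have hq := hB q q
    have hpx := hB p x
    have hxq := hB x q
    have hpq := hB p q
    rw [dist_self, zero_div, modelCos_zero] at hp hq
    rw [h1] at hpx
    rw [h2] at hxq
    rw [h3] at hpq
    have gram := modelSin_gram (κ := κ) s t
    have hst := modelSin_add (κ := κ) s t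
    obtain ⟨v0, v1, v2⟩ := eq_zero_of_null_of_orthogonal hx
      (v₀ := modelSin κ (s + t) * H₀ x - modelSin κ t * H₀ p - modelSin κ s * H₀ q)
      (v₁ := modelSin κ (s + t) * H₁ x - modelSin κ t * H₁ p - modelSin κ s * H₁ q)
      (v₂ := modelSin κ (s + t) * H₂ x - modelSin κ t * H₂ p - modelSin κ s * H₂ q)
      (by linear_combination modelSin κ (s + t) * hx + modelSin κ t * hpx + modelSin κ s * hxq + hst)
      (by linear_combination modelSin κ (s + t) ^ 2 * hx - modelSin κ t ^ 2 * hp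
            - modelSin κ s ^ 2 * hq + gram + 2 * modelSin κ (s + t) * modelSin κ t * hpx
            + 2 * modelSin κ (s + t) * modelSin κ s * hxq
            - 2 * modelSin κ t * modelSin κ s * hpq)
    rw [hB, hB, hB]
    linear_combination H₀ r * v0 - H₁ r * v1 - H₂ r * v2
  · intro a c s t ha hc hs ht h1 h2 hp
    obtain ⟨k, hk, h⟩ := exists_cos_of_sides hc h1 h2 hp
    have hlc := modelCos_of_sides h
    have hk' : √(1 - k ^ 2) ^ 2 = 1 - k ^ 2 := Real.sq_sqrt (by linarith)
    have sq := Real.sq_sqrt (neg_pos.2 hκ).le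
    have cpos : ∀ l, 0 < modelCos κ l := fun l => modelCos_pos fun h => absurd h hκ.not_gt
    have unit : ∀ l, modelCos κ l ^ 2 = 1 + (√(-κ) * modelSin κ l) ^ 2 + 0 ^ 2 := fun l => by
      linear_combination modelCos_sq_add (κ := κ) l - modelSin κ l ^ 2 * sq
    have unit' : modelCos κ a ^ 2 = 1 + (√(-κ) * modelSin κ a * k) ^ 2
        + (√(-κ) * modelSin κ a * √(1 - k ^ 2)) ^ 2 := by
      linear_combination unit a - (√(-κ) * modelSin κ a) ^ 2 * hk'
    have hlt : √(-κ) * modelSin κ a * √(1 - k ^ 2) < modelCos κ a := by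
      refine lt_of_pow_lt_pow_left₀ 2 (cpos a).le ?_
      nlinarith [sq_nonneg (√(-κ) * modelSin κ a * k)]
    refine ⟨.ofHyperboloid _ (√(-κ) * modelSin κ 0) _ (cpos 0),
      .ofHyperboloid _ (√(-κ) * modelSin κ (s + t)) _ (cpos (s + t)),
      .ofHyperboloid _ (√(-κ) * modelSin κ a * k) _ hlt,
      .ofHyperboloid _ (√(-κ) * modelSin κ s) _ (cpos s), hdist _ _ _ (add_nonneg hs ht) ?_,
      hdist _ _ _ hs ?_, hdist _ _ _ ht ?_, hdist _ _ _ ha ?_, hdist _ _ _ hc ?_⟩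
    · rw [UpperHalfPlane.cosh_dist_ofHyperboloid _ _ (unit _) (unit _)]
      simp [modelSin_zero, modelCos_zero]
    · rw [UpperHalfPlane.cosh_dist_ofHyperboloid _ _ (unit _) (unit _)]
      simp [modelSin_zero, modelCos_zero]
    · rw [UpperHalfPlane.cosh_dist_ofHyperboloid _ _ (unit _) (unit _)]
      have := modelCos_add (κ := κ) (s + t) (-s)
      rw [modelCos_neg, modelSin_neg, add_neg_cancel_comm] at this
      linear_combination -this - modelSin κ (s + t) * modelSin κ s * sq
    · rw [UpperHalfPlane.cosh_dist_ofHyperboloid _ _ (unit _) unit']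
      simp [modelSin_zero, modelCos_zero]
    · rw [UpperHalfPlane.cosh_dist_ofHyperboloid _ _ (unit _) unit']
      linear_combination -hlc - modelSin κ (s + t) * modelSin κ a * k * sq

theorem IsCAT.exists_modelPlane {X : Type*} [MetricSpace X] (h : IsCAT κ X) :
    ∃ (M : Type) (δ : M → M → ℝ), IsModelPlane κ M δ ∧ TrianglesThin κ X M δ := by
  rcases lt_trichotomy κ 0 with hκ | rfl | hκ
  · exact ⟨_, _, isModelPlane_upperHalfPlane hκ, h.thin_neg hκ⟩
  · exact ⟨_, _, isModelPlane_euclidean, h.thin_zero rfl⟩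
  · exact ⟨_, _, isModelPlane_sphere hκ, h.thin_pos hκ⟩

/-- In a CAT(κ) space, a cevian of a triangle is at most as long as the cevian `u` of the
comparison triangle, which satisfies Stewart's theorem. -/
theorem IsCAT.exists_cevian {X : Type*} [MetricSpace X] (h : IsCAT κ X) {p q : X} {γ : ℝ → X}
    (hγ : IsGeodesicBetween γ p q) (r : X) {s t : ℝ} (hs : 0 ≤ s) (ht : 0 ≤ t)
    (hst : s + t = dist p q)
    (hp : 0 < κ → dist r p + dist r q + (s + t) < 2 * (Real.pi / √κ)) :
    ∃ u, dist r (γ s) ≤ u ∧ 2 * u ≤ dist r p + dist r q + (s + t) ∧ WithinDiam κ u ∧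
      modelSin κ (s + t) * modelVer κ u = modelSin κ t * modelVer κ (dist r p)
        + modelSin κ s * modelVer κ (dist r q)
        - modelSin κ s * modelVer κ t - modelSin κ t * modelVer κ s := by
  obtain ⟨M, δ, hM, hthin⟩ := h.exists_modelPlane
  have t1 := dist_triangle p r q
  have t2 := dist_triangle r p q
  have t3 := dist_triangle r q p
  rw [dist_comm p r] at t1
  rw [dist_comm q p] at t3
  obtain ⟨p', q', r', x', hpq, hpx, hxq, hpr, hqr⟩ := hM.exists_triangle (dist r p) (dist r q) s t
    dist_nonneg dist_nonneg hs ht (abs_le.2 ⟨by linarith, by linarith⟩) (by linarith) hp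
  obtain ⟨η, hη⟩ := h.geodesic p r fun hκ => by
    have := hp hκ
    rw [dist_comm p r]
    linarith
  -- The cevian is the case in which the second point is the endpoint of `η`, whose comparison point
  -- is the vertex r'.
  have key := hthin p q r γ η hγ hη
    (fun hκ => by have := hp hκ; rw [dist_comm q r]; linarith) s ⟨hs, by linarith⟩
    (dist p r) ⟨dist_nonneg, le_rfl⟩ p' q' r' x' r' (by rw [hpq, hst]) (by rw [hqr, dist_comm])
    (by rw [hpr, dist_comm]) hpx (by rw [hxq]; linarith) (by rw [hpr, dist_comm])
    (by rw [hM.self]; ring)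
  rw [hη.target, dist_comm, hM.symm] at key
  have st := hM.stewart p' q' r' x' s t hpx hxq hpq
  have m1 := hM.triangle r' p' x'
  have m2 := hM.triangle r' q' x'
  rw [hM.symm r' p', hpr, hpx] at m1
  rw [hM.symm r' q', hqr, hM.symm q' x', hxq] at m2
  rw [hM.symm r' p', hpr, hM.symm r' q', hqr] at st
  exact ⟨δ r' x', key, by linarith, hM.within _ _, st⟩

theorem isCAT_of_modelPlane {X : Type*} [MetricSpace X] (hc : CompleteSpace X)
    (hl : IsLengthSpace X)
    (hg : ∀ p q : X, BelowDiam κ (dist p q) → ∃ γ : ℝ → X, IsGeodesicBetween γ p q)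
    (ht : ∀ (M : Type) (δ : M → M → ℝ), IsModelPlane κ M δ → TrianglesThin κ X M δ) :
    IsCAT κ X where
  complete := hc
  length := hl
  geodesic := hg
  thin_zero h := by subst h; exact ht _ _ isModelPlane_euclidean
  thin_pos h := ht _ _ (isModelPlane_sphere h)
  thin_neg h := ht _ _ (isModelPlane_upperHalfPlane h)

end ModelPlanes

/-! ### Lipschitz curves and injective arcs -/

/-- `f`, restricted to `[0, ℓ]`, is a `1`-Lipschitz curve from `p` to `q`. -/
structure IsCurve {X : Type*} [MetricSpace X] (f : ℝ → X) (p q : X) (ℓ : ℝ) : Prop where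
  lipschitz : LipschitzWith 1 f
  source : f 0 = p
  target : f ℓ = q
  nonneg : 0 ≤ ℓ

/-- `f`, restricted to `[0, ℓ]`, is an injective `1`-Lipschitz curve from `p` to `q`. -/
structure IsArc {X : Type*} [MetricSpace X] (f : ℝ → X) (p q : X) (ℓ : ℝ) : Prop
    extends IsCurve f p q ℓ where
  injOn : Set.InjOn f (Set.Icc 0 ℓ)

section Curves

variable {X : Type*} [MetricSpace X]

theorem lipschitzWith_one_of_le {f : ℝ → X} (h : ∀ s t, s ≤ t → dist (f s) (f t) ≤ t - s) :
    LipschitzWith 1 f := by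
  refine LipschitzWith.of_dist_le_mul fun s t => ?_
  rw [NNReal.coe_one, one_mul, Real.dist_eq]
  rcases le_total s t with hst | hst
  · rw [abs_sub_comm, abs_of_nonneg (by linarith)]; exact h s t hst
  · rw [abs_of_nonneg (by linarith), dist_comm]; exact h t s hst

theorem LipschitzWith.dist_le_abs_sub {f : ℝ → X} (h : LipschitzWith 1 f) (s t : ℝ) :
    dist (f s) (f t) ≤ |s - t| := by
  simpa [Real.dist_eq] using h.dist_le_mul s t

theorem IsCurve.dist_source {f : ℝ → X} {p q : X} {ℓ t : ℝ} (h : IsCurve f p q ℓ) (ht : 0 ≤ t) :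
    dist p (f t) ≤ t := by
  have := h.lipschitz.dist_le_abs_sub 0 t
  rwa [h.source, zero_sub, abs_neg, abs_of_nonneg ht] at this

theorem IsCurve.dist_target {f : ℝ → X} {p q : X} {ℓ t : ℝ} (h : IsCurve f p q ℓ) (ht : t ≤ ℓ) :
    dist (f t) q ≤ ℓ - t := by
  have := h.lipschitz.dist_le_abs_sub t ℓ
  rwa [h.target, abs_sub_comm, abs_of_nonneg (by linarith)] at this

theorem IsCurve.dist_le {f : ℝ → X} {p q : X} {ℓ : ℝ} (h : IsCurve f p q ℓ) : dist p q ≤ ℓ := by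
  simpa [h.target] using h.dist_source h.nonneg

/-- A curve whose length is controlled by a monotone function has a `1`-Lipschitz
reparametrization. -/
theorem exists_isCurve_of_monotone {c : ℝ → X} (hc : Continuous c) {V : ℝ → ℝ} {ℓ : ℝ}
    (hV0 : V 0 = 0) (hV1 : V 1 ≤ ℓ) (hV : ∀ s t, 0 ≤ s → s ≤ t → t ≤ 1 → V s ≤ V t)
    (hcV : ∀ s t, 0 ≤ s → s ≤ t → t ≤ 1 → dist (c s) (c t) ≤ V t - V s) :
    ∃ f, IsCurve f (c 0) (c 1) ℓ ∧ ∀ u, f u ∈ c '' Set.Icc 0 1 := by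
  set A : ℝ → Set ℝ := fun u => {t | t ∈ Set.Icc (0 : ℝ) 1 ∧ V t ≤ max u 0} with hA
  -- Generalized inverse of V. Continuity of V is not available, so V is only evaluated strictly
  -- inside the intervals between values of τ, and continuity of `c` passes to the endpoints
  -- (`lim`).
  set τ : ℝ → ℝ := fun u => sSup (A u) with hτ
  have bdd : ∀ u, BddAbove (A u) := fun u => ⟨1, fun t ht => ht.1.2⟩
  have mem0 : ∀ u, (0 : ℝ) ∈ A u := fun u => ⟨⟨le_rfl, zero_le_one⟩, by rw [hV0]; exact le_max_right _ _⟩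
  have τ0 : ∀ u, 0 ≤ τ u := fun u => le_csSup (bdd u) (mem0 u)
  have τ1 : ∀ u, τ u ≤ 1 := fun u => csSup_le ⟨0, mem0 u⟩ fun t ht => ht.1.2
  have τmono : ∀ u v, u ≤ v → τ u ≤ τ v := fun u v huv =>
    csSup_le_csSup (bdd v) ⟨0, mem0 u⟩ fun t ht => ⟨ht.1, ht.2.trans (max_le_max_right 0 huv)⟩
  have below : ∀ u t, 0 ≤ t → t < τ u → V t ≤ max u 0 := by
    intro u t ht htu
    obtain ⟨t', ht', h⟩ := exists_lt_of_lt_csSup ⟨0, mem0 u⟩ htu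
    exact (hV t t' ht h.le ht'.1.2).trans ht'.2
  have above : ∀ u t, t ≤ 1 → τ u < t → max u 0 ≤ V t := by
    intro u t ht htu
    by_contra! h
    exact absurd (le_csSup (bdd u) ⟨⟨(τ0 u).trans htu.le, ht⟩, h.le⟩) htu.not_ge
  have lim : ∀ (C a b : ℝ), a < b → (∀ s t, a < s → s < t → t < b → dist (c s) (c t) ≤ C) →
      dist (c a) (c b) ≤ C := by
    intro C a b hab h
    have h1 : ∀ t, a < t → t < b → dist (c a) (c t) ≤ C := by
      intro t hat htb
      have : Set.Icc a t ⊆ {s | dist (c s) (c t) ≤ C} := by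
        rw [← closure_Ioo hat.ne]
        exact closure_minimal (fun s hs => h s t hs.1 hs.2 htb)
          (isClosed_le (by fun_prop) continuous_const)
      exact this ⟨le_rfl, hat.le⟩
    have : Set.Icc a b ⊆ {t | dist (c a) (c t) ≤ C} := by
      rw [← closure_Ioo hab.ne]
      exact closure_minimal (fun t ht => h1 t ht.1 ht.2)
        (isClosed_le (by fun_prop) continuous_const)
    exact this ⟨hab.le, le_rfl⟩
  have hℓ : 0 ≤ ℓ := by linarith [hV 0 1 le_rfl zero_le_one le_rfl]
  refine ⟨fun u => c (τ u), ⟨lipschitzWith_one_of_le fun u v huv => ?_, ?_, ?_, hℓ⟩,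
    fun u => ⟨τ u, ⟨τ0 u, τ1 u⟩, rfl⟩⟩
  · rcases (τmono u v huv).eq_or_lt with h | h
    · rw [h, dist_self]; linarith
    · refine lim _ _ _ h fun s t hs hst ht => ?_
      have h1 := hcV s t ((τ0 u).trans hs.le) hst.le (ht.le.trans (τ1 v))
      have h2 := above u s (hst.le.trans (ht.le.trans (τ1 v))) hs
      have h3 := below v t ((τ0 u).trans (hs.le.trans hst.le)) ht
      have h4 : max v 0 - max u 0 ≤ v - u := by
        rcases max_cases v 0 with hv | hv <;> rcases max_cases u 0 with hu | hu <;> linarith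
      linarith
  · rcases (τ0 0).eq_or_lt with h | h
    · simp only [← h]
    · have : dist (c 0) (c (τ 0)) ≤ 0 := lim _ _ _ h fun s t hs hst ht => by
        have h1 := hcV s t hs.le hst.le (ht.le.trans (τ1 0))
        have h2 := below 0 t (hs.le.trans hst.le) ht
        have h3 := hV 0 s le_rfl hs.le (hst.le.trans (ht.le.trans (τ1 0)))
        rw [max_self] at h2
        linarith
      exact (dist_le_zero.1 this).symm
  · have : τ ℓ = 1 := le_antisymm (τ1 ℓ)
      (le_csSup (bdd ℓ) ⟨⟨zero_le_one, le_rfl⟩, hV1.trans (le_max_left _ _)⟩)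
    simp only [this]

theorem IsLengthSpace.exists_isCurve (hX : IsLengthSpace X) (p q : X) {ε : ℝ} (hε : 0 < ε) :
    ∃ f K, IsCompact K ∧ IsCurve f p q (dist p q + ε) ∧ ∀ u, f u ∈ K := by
  have hlt : ⨅ γ : Path p q, eVariationOn γ Set.univ < ENNReal.ofReal (dist p q + ε) := by
    rw [← hX p q, edist_dist]
    exact (ENNReal.ofReal_lt_ofReal_iff (by positivity)).2 (by linarith)
  obtain ⟨γ, hγ⟩ := iInf_lt_iff.1 hlt
  have hle : eVariationOn γ.extend (Set.Icc 0 1) ≤ ENNReal.ofReal (dist p q + ε) :=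
    (eVariationOn.comp_le_of_monotoneOn (⇑γ) (t := Set.Icc (0 : ℝ) 1) (s := Set.univ)
      (Set.projIcc 0 1 zero_le_one) ((Set.monotone_projIcc _).monotoneOn _)
      (Set.mapsTo_univ _ _)).trans hγ.le
  have hfin : ∀ t ≤ 1, eVariationOn γ.extend (Set.Icc 0 t) ≠ ⊤ := fun t ht =>
    ((eVariationOn.mono _ (Set.Icc_subset_Icc_right ht)).trans_lt
      (hle.trans_lt ENNReal.ofReal_lt_top)).ne
  have hadd : ∀ s t, 0 ≤ s → s ≤ t → eVariationOn γ.extend (Set.Icc 0 s)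
      + edist (γ.extend s) (γ.extend t) ≤ eVariationOn γ.extend (Set.Icc 0 t) := by
    intro s t hs hst
    have := eVariationOn.Icc_add_Icc γ.extend (s := Set.univ) hs hst (Set.mem_univ _)
    simp only [Set.univ_inter] at this
    rw [← this]
    gcongr
    exact eVariationOn.edist_le _ ⟨le_rfl, hst⟩ ⟨hst, le_rfl⟩
  obtain ⟨f, hf, hfK⟩ := exists_isCurve_of_monotone (c := γ.extend) γ.continuous_extend
    (V := fun t => (eVariationOn γ.extend (Set.Icc 0 t)).toReal) (ℓ := dist p q + ε)
    (by simp [eVariationOn.subsingleton])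
    (ENNReal.toReal_le_of_le_ofReal (by positivity) hle)
    (fun s t hs hst ht => ENNReal.toReal_mono (hfin t ht)
      (eVariationOn.mono _ (Set.Icc_subset_Icc_right hst)))
    (fun s t hs hst ht => by
      have h1 := ENNReal.toReal_mono (hfin t ht) (hadd s t hs hst)
      rw [ENNReal.toReal_add (hfin s (hst.trans ht)) (edist_ne_top _ _), ← dist_edist] at h1
      linarith)
  rw [γ.extend_zero, γ.extend_one] at hf
  exact ⟨f, _, isCompact_Icc.image γ.continuous_extend, hf, hfK⟩

/-- A curve in a compact set can be replaced by a shortest one, which is injective. -/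
theorem IsCurve.exists_isArc {K : Set X} (hK : IsCompact K) {f : ℝ → X} {p q : X} {ℓ : ℝ}
    (hf : IsCurve f p q ℓ) (hfK : ∀ u, f u ∈ K) : ∃ g l, IsArc g p q l ∧ l ≤ ℓ := by
  -- Compact by Tychonoff for the topology of pointwise convergence. Evaluation (g, l) ↦ g l is not
  -- jointly continuous there, so g l = q is replaced by the closed condition d(g t, q) ≤ |t - l|
  -- for all t.
  set S : Set ((ℝ → X) × ℝ) := ((Set.univ.pi fun _ => K) ×ˢ Set.Icc 0 ℓ) ∩
    {x | (∀ s t, dist (x.1 s) (x.1 t) ≤ |s - t|) ∧ x.1 0 = p ∧ ∀ t, dist (x.1 t) q ≤ |t - x.2|}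
    with hS
  have hSc : IsCompact S := by
    refine ((isCompact_univ_pi fun _ => hK).prod isCompact_Icc).inter_right ?_
    simp only [Set.ofPred_and, Set.ofPred_forall]
    refine (isClosed_iInter fun s => isClosed_iInter fun t => isClosed_le ?_ ?_).inter
      ((isClosed_eq ?_ ?_).inter (isClosed_iInter fun t => isClosed_le ?_ ?_)) <;> fun_prop
  have curve : ∀ (g : ℝ → X) (l : ℝ), (∀ u, g u ∈ K) → IsCurve g p q l → l ≤ ℓ → (g, l) ∈ S := by
    intro g l hgK hg hl
    refine ⟨⟨fun u _ => hgK u, hg.nonneg, hl⟩, hg.lipschitz.dist_le_abs_sub, hg.source, fun t => ?_⟩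
    have := hg.lipschitz.dist_le_abs_sub t l
    rwa [hg.target] at this
  obtain ⟨⟨g, l⟩, ⟨⟨hgK, hl⟩, hg1, hg2, hg3⟩, hmin⟩ :=
    hSc.exists_isMinOn ⟨_, curve f ℓ hfK hf le_rfl⟩ continuous_snd.continuousOn
  simp only at hgK hl hg1 hg2 hg3
  have hgl : g l = q := dist_le_zero.1 (by simpa using hg3 l)
  have hlip : LipschitzWith 1 g := lipschitzWith_one_of_le fun s t hst => by
    have := hg1 s t
    rwa [abs_sub_comm, abs_of_nonneg (by linarith)] at this
  have key : ∀ a b, 0 ≤ a → a < b → b ≤ l → g a ≠ g b := by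
    intro a b ha hab hb he
    -- Cutting out the loop between a and b would shorten the minimal curve by b - a.
    have hcut : IsCurve (fun t => if t ≤ a then g t else g (t + (b - a))) p q (l - (b - a)) := by
      refine ⟨lipschitzWith_one_of_le fun s t hst => ?_, by simp [ha, hg2], ?_, by linarith⟩
      · split_ifs with h1 h2 h2
        · exact (hg1 s t).trans (by rw [abs_sub_comm, abs_of_nonneg (by linarith)])
        · have e1 := hg1 s a
          have e2 := hg1 b (t + (b - a))
          rw [abs_sub_comm, abs_of_nonneg (by linarith)] at e1 e2
          have := dist_triangle (g s) (g a) (g (t + (b - a)))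
          rw [he] at this e1
          linarith
        · linarith
        · refine (hg1 _ _).trans ?_
          rw [abs_sub_comm, abs_of_nonneg (by linarith)]; linarith
      · split_ifs with h
        · have : b = l := by linarith
          subst this
          rw [show b - (b - a) = a by ring, he, hgl]
        · rw [sub_add_cancel, hgl]
    have hm := hmin (curve _ _ (fun u => by
      split_ifs <;> exact hgK _ (Set.mem_univ _)) hcut (by linarith [hl.2]))
    simp only [Set.mem_ofPred_eq] at hm
    linarith
  refine ⟨g, l, ⟨⟨hlip, hg2, hgl, hl.1⟩, fun a ha b hb hab => ?_⟩, hl.2⟩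
  by_contra hne
  rcases lt_or_gt_of_ne hne with h | h
  · exact key a b ha.1 h hb.2 hab
  · exact key b a hb.1 h ha.2 hab.symm

theorem IsLengthSpace.exists_isArc (hX : IsLengthSpace X) (p q : X) {ε : ℝ} (hε : 0 < ε) :
    ∃ f ℓ, IsArc f p q ℓ ∧ ℓ ≤ dist p q + ε := by
  obtain ⟨f, K, hK, hf, hfK⟩ := hX.exists_isCurve p q hε
  exact hf.exists_isArc hK hfK

theorem IsGeodesicBetween.isArc {γ : ℝ → X} {p q : X} (h : IsGeodesicBetween γ p q) :
    ∃ f, IsArc f p q (dist p q) ∧ Set.EqOn f γ (Set.Icc 0 (dist p q)) := by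
  have h0 : (0 : ℝ) ≤ dist p q := dist_nonneg
  have heq : Set.EqOn (fun t => γ (Set.projIcc 0 (dist p q) h0 t)) γ (Set.Icc 0 (dist p q)) :=
    fun t ht => by simp only [Set.projIcc_of_mem h0 ht]
  refine ⟨fun t => γ (Set.projIcc 0 (dist p q) h0 t), ⟨⟨?_, ?_, ?_, h0⟩, ?_⟩, heq⟩
  · refine LipschitzWith.of_dist_le_mul fun s t => ?_
    rw [h.isometric _ (Subtype.prop _) _ (Subtype.prop _), NNReal.coe_one, one_mul,
      ← Real.dist_eq, ← Subtype.dist_eq]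
    simpa using (LipschitzWith.projIcc h0).dist_le_mul s t
  · exact (heq ⟨le_rfl, h0⟩).trans h.source
  · exact (heq ⟨h0, le_rfl⟩).trans h.target
  · refine heq.injOn_iff.2 fun s hs t ht hst => ?_
    have := h.isometric s hs t ht
    rw [hst, dist_self] at this
    exact sub_eq_zero.1 (abs_eq_zero.1 this.symm)

theorem isGeodesicBetween_of_dist_le {γ : ℝ → X} {p q : X} (h0 : γ 0 = p) (h1 : γ (dist p q) = q)
    (h : ∀ s t, 0 ≤ s → s ≤ t → t ≤ dist p q → dist (γ s) (γ t) ≤ t - s) :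
    IsGeodesicBetween γ p q := by
  have key : ∀ s t, 0 ≤ s → s ≤ t → t ≤ dist p q → dist (γ s) (γ t) = t - s := by
    intro s t hs hst ht
    have e1 := h 0 s le_rfl hs (hst.trans ht)
    have e2 := h t _ (hs.trans hst) ht le_rfl
    have e3 := h s t hs hst ht
    rw [h0] at e1
    rw [h1] at e2
    linarith [dist_triangle4 p (γ s) (γ t) q]
  refine ⟨h0, h1, fun s hs t ht => ?_⟩
  rcases le_total s t with hst | hst
  · rw [key s t hs.1 hst ht.2, abs_sub_comm, abs_of_nonneg (by linarith)]
  · rw [dist_comm, key t s ht.1 hst hs.2, abs_of_nonneg (by linarith)]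

end Curves

/-! ### Lifting simple loops to CAT(κ) spaces -/

/-- Every Jordan curve in `X` of length less than `2Λ` is majorized by some CAT(κ) space. -/
def MajorizedByCAT (κ Λ : ℝ) (X : Type u) [MetricSpace X] : Prop :=
  ∀ Γ : Set X, IsJordanCurve Γ → jordanLength Γ < ENNReal.ofReal (2 * Λ) →
    ∃ (Y : Type v) (_ : MetricSpace Y), IsCAT κ Y ∧ Majorizes Y Γ

section Loops

variable {X : Type u} [MetricSpace X]

theorem eVariationOn_Icc_le_of_lipschitzOnWith {g : ℝ → X} {a b : ℝ}
    (hg : LipschitzOnWith 1 g (Set.Icc a b)) :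
    eVariationOn g (Set.Icc a b) ≤ ENNReal.ofReal (b - a) := by
  have := hg.comp_eVariationOn_le (f := g) (g := id) (s := Set.Icc a b) fun x hx => hx
  simpa [eVariationOn_id_Icc] using this

theorem jordanCurve_of_loop {g : ℝ → X} {T : ℝ} (hT : 0 < T)
    (hg : LipschitzOnWith 1 g (Set.Icc 0 T)) (hloop : g 0 = g T)
    (hinj : Set.InjOn g (Set.Ico 0 T)) :
    IsJordanCurve (g '' Set.Icc 0 T) ∧ jordanLength (g '' Set.Icc 0 T) ≤ ENNReal.ofReal T := by
  have : Fact (0 < 2 * Real.pi) := ⟨Real.two_pi_pos⟩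
  have hπ := Real.two_pi_pos
  set φ : ℝ → ℝ := fun x => T / (2 * Real.pi) * x with hφ
  have hφmem : ∀ x ∈ Set.Icc 0 (2 * Real.pi), φ x ∈ Set.Icc 0 T := by
    intro x hx
    refine ⟨mul_nonneg (by positivity) hx.1, ?_⟩
    calc T / (2 * Real.pi) * x ≤ T / (2 * Real.pi) * (2 * Real.pi) := by gcongr; exact hx.2
      _ = T := by field_simp
  have hφmem' : ∀ x ∈ Set.Ico 0 (2 * Real.pi), φ x ∈ Set.Ico 0 T := by
    intro x hx
    refine ⟨mul_nonneg (by positivity) hx.1, ?_⟩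
    calc T / (2 * Real.pi) * x < T / (2 * Real.pi) * (2 * Real.pi) := by gcongr; exact hx.2
      _ = T := by field_simp
  have hφ0 : φ 0 = 0 := by simp [hφ]
  have hφT : φ (2 * Real.pi) = T := by simp only [hφ]; field_simp
  have hends : (g ∘ φ) 0 = (g ∘ φ) (2 * Real.pi) := by
    simp only [Function.comp, hφ0, hφT, hloop]
  set h : AddCircle (2 * Real.pi) → X := AddCircle.liftIco (2 * Real.pi) 0 (g ∘ φ) with hh
  have hcont : Continuous h := AddCircle.liftIco_zero_continuous hends
    (hg.continuousOn.comp (by fun_prop) hφmem)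
  have hcoe : ∀ x ∈ Set.Ico 0 (2 * Real.pi), h (x : AddCircle (2 * Real.pi)) = g (φ x) :=
    fun x hx => AddCircle.liftIco_zero_coe_apply hx
  have hcoe' : ∀ x ∈ Set.Icc 0 (2 * Real.pi), h (x : AddCircle (2 * Real.pi)) = g (φ x) := by
    intro x hx
    rcases hx.2.eq_or_lt with rfl | hlt
    · have := hcoe 0 ⟨le_rfl, hπ⟩
      rw [AddCircle.coe_period, ← AddCircle.coe_zero, this, hφ0, hφT, hloop]
    · exact hcoe x ⟨hx.1, hlt⟩
  have hrep : ∀ a : AddCircle (2 * Real.pi), ∃ x ∈ Set.Ico 0 (2 * Real.pi), (x : AddCircle _) = a :=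
    fun a => ⟨_, by simpa using (AddCircle.equivIco (2 * Real.pi) 0 a).2,
      (AddCircle.equivIco (2 * Real.pi) 0).symm_apply_apply a⟩
  have hinj' : Function.Injective h := by
    intro a b hab
    obtain ⟨x, hx, rfl⟩ := hrep a
    obtain ⟨y, hy, rfl⟩ := hrep b
    rw [hcoe x hx, hcoe y hy] at hab
    have := hinj (hφmem' x hx) (hφmem' y hy) hab
    have hxy : x = y := mul_left_cancel₀ (by positivity) this
    rw [hxy]
  have hmem : ∀ a, h a ∈ g '' Set.Icc 0 T := by
    intro a
    obtain ⟨x, hx, rfl⟩ := hrep a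
    rw [hcoe x hx]
    exact ⟨_, hφmem x ⟨hx.1, hx.2.le⟩, rfl⟩
  have hbij : Function.Bijective fun a => (⟨h a, hmem a⟩ : g '' Set.Icc 0 T) := by
    refine ⟨fun a b hab => hinj' (congrArg Subtype.val hab), ?_⟩
    rintro ⟨_, t, ht, rfl⟩
    have hx : t * (2 * Real.pi) / T ∈ Set.Icc 0 (2 * Real.pi) := by
      refine ⟨by have := ht.1; positivity, ?_⟩
      rw [div_le_iff₀ hT, mul_comm]
      gcongr
      exact ht.2
    refine ⟨((t * (2 * Real.pi) / T : ℝ) : AddCircle (2 * Real.pi)), Subtype.ext ?_⟩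
    simp only
    rw [hcoe' _ hx, hφ]
    congr 1
    field_simp
  have hcont' : Continuous (Equiv.ofBijective _ hbij) := by
    exact hcont.subtype_mk _
  let e : AddCircle (2 * Real.pi) ≃ₜ g '' Set.Icc 0 T := hcont'.homeoOfEquivCompactToT2
  let ψ : Circle ≃ₜ g '' Set.Icc 0 T := AddCircle.homeomorphCircle'.symm.trans e
  refine ⟨⟨ψ⟩, (iInf_le _ ψ).trans ?_⟩
  have hψ : Set.EqOn (fun t : ℝ => (ψ (Circle.exp t) : X)) (g ∘ φ) (Set.Icc 0 (2 * Real.pi)) := by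
    intro t ht
    have h1 : AddCircle.homeomorphCircle'.symm (Circle.exp t) = (t : AddCircle (2 * Real.pi)) := by
      rw [Homeomorph.symm_apply_eq]; rfl
    change h (AddCircle.homeomorphCircle'.symm (Circle.exp t)) = g (φ t)
    rw [h1, hcoe' t ht]
  rw [eVariationOn.congr hψ]
  refine (eVariationOn.comp_le_of_monotoneOn g φ ?_ hφmem).trans ?_
  · exact fun x _ y _ hxy => mul_le_mul_of_nonneg_left hxy (by positivity)
  · simpa using eVariationOn_Icc_le_of_lipschitzOnWith hg

/-- A simple loop in `X` lifts to a loop in a CAT(κ) space. -/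
theorem MajorizedByCAT.exists_lift {κ Λ : ℝ} (hmaj : MajorizedByCAT.{u, v} κ Λ X) {g : ℝ → X}
    {T : ℝ} (hT : 0 < T) (hTΛ : T < 2 * Λ) (hg : LipschitzOnWith 1 g (Set.Icc 0 T))
    (hloop : g 0 = g T) (hinj : Set.InjOn g (Set.Ico 0 T)) :
    ∃ (Y : Type v) (_ : MetricSpace Y) (P : Y → X) (c : ℝ → Y), IsCAT κ Y ∧ LipschitzWith 1 P ∧
      (∀ t ∈ Set.Icc 0 T, P (c t) = g t) ∧
      (∀ s t, 0 ≤ s → s ≤ t → t ≤ T → dist (c s) (c t) ≤ t - s) ∧ c 0 = c T := by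
  obtain ⟨hJ, hlen⟩ := jordanCurve_of_loop hT hg hloop hinj
  obtain ⟨Y, _, hY, P, hP, Γ', ⟨e'⟩, hbij, harc⟩ := hmaj _ hJ
    (hlen.trans_lt ((ENNReal.ofReal_lt_ofReal_iff (by linarith)).2 hTΛ))
  have : CompactSpace Γ' := e'.compactSpace
  have hcont : Continuous (hbij.equiv P) := by
    refine Continuous.subtype_mk (hP.continuous.comp continuous_subtype_val) _
  -- A continuous bijection from a compact space to a Hausdorff space, so its inverse gives a
  -- continuous lift `c` of the loop.
  let e : Γ' ≃ₜ g '' Set.Icc 0 T := hcont.homeoOfEquivCompactToT2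
  set c : ℝ → Y := fun t => e.symm ⟨g (Set.projIcc 0 T hT.le t), _, Subtype.prop _, rfl⟩ with hc
  have hPc : ∀ t ∈ Set.Icc 0 T, P (c t) = g t := by
    intro t ht
    have := congrArg Subtype.val
      (e.apply_symm_apply ⟨g (Set.projIcc 0 T hT.le t), _, Subtype.prop _, rfl⟩)
    refine Eq.trans this ?_
    simp only [Set.projIcc_of_mem hT.le ht]
  have hcc : Continuous c := by
    refine continuous_subtype_val.comp (e.symm.continuous.comp (Continuous.subtype_mk ?_ _))
    exact hg.continuousOn.comp_continuous (by fun_prop) fun t => Subtype.prop _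
  have hloop' : c 0 = c T := by
    simp only [hc, Set.projIcc_left, Set.projIcc_right, hloop]
  refine ⟨Y, _, P, c, hY, hP, hPc, fun s t hs hst ht => ?_, hloop'⟩
  -- Preservation of arc length is only given for injective paths, so the full loop is treated
  -- apart; its endpoints coincide.
  by_cases hends : s = 0 ∧ t = T
  · rw [hends.1, hends.2, hloop', dist_self]; linarith
  · have hsub : Set.Icc s t ⊆ Set.Icc 0 T := Set.Icc_subset_Icc hs ht
    have hcinj : Set.InjOn c (Set.Icc s t) := by
      have hginj : Set.InjOn g (Set.Icc s t) := by
        have aux : ∀ a b, s ≤ a → a < b → b ≤ t → g a ≠ g b := by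
          intro a b ha hab hb he
          rcases (hb.trans ht).eq_or_lt with rfl | hbT
          · rw [← hloop] at he
            have : a = 0 := hinj ⟨hs.trans ha, hab⟩ ⟨le_rfl, hT⟩ he
            exact hends ⟨by linarith, by linarith⟩
          · exact hab.ne (hinj ⟨hs.trans ha, hab.trans hbT⟩ ⟨hs.trans (ha.trans hab.le), hbT⟩ he)
        intro a ha b hb hab
        by_contra hne
        rcases lt_or_gt_of_ne hne with h | h
        · exact aux a b ha.1 h hb.2 hab
        · exact aux b a hb.1 h ha.2 hab.symm
      intro a ha b hb hab
      exact hginj ha hb (by rw [← hPc a (hsub ha), ← hPc b (hsub hb), hab])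
    have h1 := harc c s t hcc.continuousOn hcinj fun x _ => Subtype.prop _
    rw [eVariationOn.congr (f := P ∘ c) (g := g) fun x hx => hPc x (hsub hx)] at h1
    have h2 : edist (c s) (c t) ≤ ENNReal.ofReal (t - s) := by
      refine (eVariationOn.edist_le c (s := Set.Icc s t) ⟨le_rfl, hst⟩ ⟨hst, le_rfl⟩).trans ?_
      rw [← h1]
      exact eVariationOn_Icc_le_of_lipschitzOnWith (hg.mono hsub)
    rw [edist_dist] at h2
    exact (ENNReal.ofReal_le_ofReal_iff (by linarith)).1 h2

/-- Concatenation of `f` on `(-∞, a]` with `g`, shifted to start at time `a`. -/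
noncomputable def concatAt {X : Type*} (f : ℝ → X) (a : ℝ) (g : ℝ → X) (t : ℝ) : X :=
  if t < a then f t else g (t - a)

omit [MetricSpace X] in
theorem concatAt_of_lt {f g : ℝ → X} {a t : ℝ} (h : t < a) : concatAt f a g t = f t := by
  simp [concatAt, h]

omit [MetricSpace X] in
theorem concatAt_of_le {f g : ℝ → X} {a t : ℝ} (h : a ≤ t) : concatAt f a g t = g (t - a) := by
  simp [concatAt, h.not_gt]

theorem concatAt_lipschitzWith {f g : ℝ → X} {a : ℝ} (hf : LipschitzWith 1 f)
    (hg : LipschitzWith 1 g) (h : f a = g 0) : LipschitzWith 1 (concatAt f a g) := by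
  refine lipschitzWith_one_of_le fun s t hst => ?_
  have bd : ∀ {f : ℝ → X}, LipschitzWith 1 f → ∀ s t, s ≤ t → dist (f s) (f t) ≤ t - s := by
    intro f hf s t hst
    have := hf.dist_le_abs_sub s t
    rwa [abs_sub_comm, abs_of_nonneg (by linarith)] at this
  rcases lt_or_ge t a with ht | ht
  · rw [concatAt_of_lt ht, concatAt_of_lt (hst.trans_lt ht)]
    exact bd hf s t hst
  · rw [concatAt_of_le ht]
    rcases lt_or_ge s a with hs | hs
    · rw [concatAt_of_lt hs]
      have h1 := bd hf s a hs.le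
      have h2 := bd hg 0 (t - a) (by linarith)
      have := dist_triangle (f s) (f a) (g (t - a))
      rw [h] at this h1
      linarith
    · rw [concatAt_of_le hs]
      linarith [bd hg (s - a) (t - a) (by linarith)]

omit [MetricSpace X] in
theorem concatAt_injOn {f g : ℝ → X} {a b : ℝ} (hf : Set.InjOn f (Set.Ico 0 a))
    (hg : Set.InjOn g (Set.Ico 0 b))
    (hd : ∀ s ∈ Set.Ico 0 a, ∀ t ∈ Set.Ico 0 b, f s ≠ g t) :
    Set.InjOn (concatAt f a g) (Set.Ico 0 (a + b)) := by
  intro s hs t ht hst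
  rcases lt_or_ge s a with h1 | h1 <;> rcases lt_or_ge t a with h2 | h2
  · rw [concatAt_of_lt h1, concatAt_of_lt h2] at hst
    exact hf ⟨hs.1, h1⟩ ⟨ht.1, h2⟩ hst
  · rw [concatAt_of_lt h1, concatAt_of_le h2] at hst
    exact absurd hst (hd s ⟨hs.1, h1⟩ _ ⟨by linarith, by linarith [ht.2]⟩)
  · rw [concatAt_of_le h1, concatAt_of_lt h2] at hst
    exact absurd hst.symm (hd t ⟨ht.1, h2⟩ _ ⟨by linarith, by linarith [hs.2]⟩)
  · rw [concatAt_of_le h1, concatAt_of_le h2] at hst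
    linarith [hg ⟨by linarith, by linarith [hs.2]⟩ ⟨by linarith, by linarith [ht.2]⟩ hst]

end Loops

/-! ### Existence of geodesics -/

/-- A triangle whose sides exceed the parts of the base by at most ε is nearly degenerate, hence has
a short cevian. In Stewart's inequality the increments v(a) - v(s) and v(c) - v(t) are O(S(ε/2)),
and their weights S(t), S(s) add up to at most a constant times S(s + t), uniformly in s and t. -/
theorem exists_cevian_bound {κ L : ℝ} (hL0 : 0 ≤ L) (hL : BelowDiam κ L) {η : ℝ} (hη : 0 < η) :
    ∃ ε₀ > 0, ∀ ε, 0 < ε → ε ≤ ε₀ → ∀ s t a c m, 0 ≤ s → 0 ≤ t → 0 ≤ a → 0 ≤ c → s + t ≤ L →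
      a ≤ s + ε → c ≤ t + ε → 2 * m ≤ a + c + (s + t) → WithinDiam κ m →
      StewartLE κ a c s t m → m ≤ η := by
  obtain ⟨δ, hδ, hLδ⟩ : ∃ δ > 0, BelowDiam κ (L + δ) := by
    by_cases hκ : 0 < κ
    · have := hL hκ
      exact ⟨(Real.pi / √κ - L) / 2, by linarith, fun _ => by linarith⟩
    · exact ⟨1, one_pos, fun h => absurd h hκ⟩
  obtain ⟨C, hC, hCb⟩ := exists_modelSin_add_modelSin_le hL
  obtain ⟨B, hB⟩ := (isCompact_Icc (a := 0) (b := L + 1)).exists_bound_of_continuousOn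
    (continuous_modelSin (κ := κ)).continuousOn
  -- η is capped below the diameter: for κ > 0 the periodic function v could vanish at η itself.
  have hη' : 0 < modelVer κ (min η (L + δ)) := by
    have := modelVer_lt (κ := κ) le_rfl (lt_min hη (by linarith : 0 < L + δ))
      (hLδ.mono (min_le_right _ _)).within
    rwa [modelVer_zero] at this
  have hlim : Filter.Tendsto (fun ε => C * (2 * B * modelSin κ (ε / 2))) (nhds 0) (nhds 0) := by
    have hc := continuous_modelSin (κ := κ)
    have : Continuous fun ε => C * (2 * B * modelSin κ (ε / 2)) := by fun_prop
    simpa [modelSin_zero] using this.tendsto 0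
  obtain ⟨ε₁, hε₁, hsmall⟩ := Metric.eventually_nhds_iff.1 (hlim.eventually (gt_mem_nhds hη'))
  refine ⟨min (min (ε₁ / 2) δ) (min η 1), by positivity, ?_⟩
  intro ε hε hε' s t a c m hs ht ha hc hst has hct hm hmw h
  have i1 : ε ≤ ε₁ / 2 := hε'.trans ((min_le_left _ _).trans (min_le_left _ _))
  have i2 : ε ≤ δ := hε'.trans ((min_le_left _ _).trans (min_le_right _ _))
  have i3 : ε ≤ η := hε'.trans ((min_le_right _ _).trans (min_le_left _ _))
  have i4 : ε ≤ 1 := hε'.trans ((min_le_right _ _).trans (min_le_right _ _))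
  rcases (add_nonneg hs ht).eq_or_lt with h0 | h0
  · linarith
  have hsε : 0 ≤ modelSin κ (ε / 2) :=
    modelSin_nonneg (by linarith) (hLδ.mono (by linarith)).within
  have incr : ∀ x y, 0 ≤ x → x ≤ L → 0 ≤ y → y ≤ x + ε →
      modelVer κ y - modelVer κ x ≤ 2 * B * modelSin κ (ε / 2) := by
    intro x y hx hxL hy hyx
    have e1 := modelVer_le hy hyx (hLδ.mono (by linarith)).within
    have e2 := modelVer_sub_modelVer (κ := κ) x (x + ε)
    rw [add_sub_cancel_left] at e2
    have e3 := le_of_abs_le (hB ((x + (x + ε)) / 2) ⟨by linarith, by linarith⟩)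
    have e4 := mul_le_mul_of_nonneg_right e3 hsε
    linarith
  have hT := modelSin_nonneg ht (hL.mono (by linarith)).within
  have hS := modelSin_nonneg hs (hL.mono (by linarith)).within
  have j1 := mul_le_mul_of_nonneg_left (incr s a hs (by linarith) ha has) hT
  have j2 := mul_le_mul_of_nonneg_left (incr t c ht (by linarith) hc hct) hS
  have hω : 0 ≤ 2 * B * modelSin κ (ε / 2) := by
    have := (norm_nonneg _).trans (hB 0 ⟨le_rfl, by linarith⟩)
    positivity
  have j3 := mul_le_mul_of_nonneg_right (hCb s t hs ht hst) hω
  have hpos := modelSin_pos h0 (hL.mono hst)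
  have j4 : modelVer κ m ≤ C * (2 * B * modelSin κ (ε / 2)) := by
    refine le_of_mul_le_mul_left ?_ hpos
    unfold StewartLE at h
    linarith
  have j5 := hsmall (y := ε) (by rw [Real.dist_eq, sub_zero, abs_of_pos hε]; linarith)
  exact (le_of_modelVer_le (by positivity) hmw (j4.trans j5.le)).trans (min_le_left _ _)

section Geodesics

variable {X : Type u} [MetricSpace X] {κ Λ : ℝ}

/-- If the lengths exceed the distance by at most ε, going along one curve to a common point and on
along the other cannot save more than ε, so the two parameters of that point nearly agree. -/
theorem IsCurve.abs_sub_le {f₁ f₂ : ℝ → X} {p q : X} {ℓ₁ ℓ₂ ε a b : ℝ} (h₁ : IsCurve f₁ p q ℓ₁)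
    (h₂ : IsCurve f₂ p q ℓ₂) (hl₁ : ℓ₁ ≤ dist p q + ε) (hl₂ : ℓ₂ ≤ dist p q + ε)
    (ha : a ∈ Set.Icc 0 ℓ₁) (hb : b ∈ Set.Icc 0 ℓ₂) (hab : f₁ a = f₂ b) : |a - b| ≤ ε := by
  have e1 := h₁.dist_source ha.1
  have e2 := h₁.dist_target ha.2
  have e3 := h₂.dist_source hb.1
  have e4 := h₂.dist_target hb.2
  have e5 := dist_triangle p (f₁ a) q
  rw [hab] at e1 e2 e5
  exact abs_le.2 ⟨by linarith, by linarith⟩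

/-- Around a time τ at which f₁ is off f₂, the maximal excursion of f₁ and the part of f₂ between
the same points form a simple loop. In the lift both arcs are almost as short as the geodesic
between their endpoints, so `exists_cevian_bound` places them near it. -/
theorem MajorizedByCAT.arcs_close (hmaj : MajorizedByCAT.{u, v} κ Λ X)
    (hκΛ : 0 < κ → Λ ≤ Real.pi / √κ) {p q : X} (hpq : dist p q < Λ) {η : ℝ} (hη : 0 < η) :
    ∃ ε > 0, ∀ f₁ f₂ ℓ₁ ℓ₂, IsArc f₁ p q ℓ₁ → IsArc f₂ p q ℓ₂ → ℓ₁ ≤ dist p q + ε →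
      ℓ₂ ≤ dist p q + ε → ∀ t ∈ Set.Icc 0 (dist p q), dist (f₁ t) (f₂ t) ≤ η := by
  have hd : 0 ≤ dist p q := dist_nonneg
  set L := (dist p q + Λ) / 2 with hLdef
  have hLΛ : L < Λ := by linarith
  have hL : BelowDiam κ L := fun hκ => hLΛ.trans_le (hκΛ hκ)
  obtain ⟨ε₀, hε₀, hbound⟩ := exists_cevian_bound (κ := κ) (L := L) (by linarith) hL
    (η := η / 7) (by linarith)
  -- Error budget: two cevians of η/7, then 2ε from a short excursion and 3ε for passing from time σ
  -- to τ, with ε ≤ η/7. The bound by L - d(p, q) keeps both arcs no longer than L.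
  obtain ⟨ε, hε, hε1, hε2, hε3⟩ : ∃ ε > 0, 3 * ε ≤ ε₀ ∧ ε ≤ L - dist p q ∧ ε ≤ η / 7 := by
    refine ⟨min (ε₀ / 3) (min (L - dist p q) (η / 7)), ?_, ?_, ?_, ?_⟩
    · exact lt_min (by linarith) (lt_min (by linarith) (by linarith))
    · linarith [min_le_left (ε₀ / 3) (min (L - dist p q) (η / 7))]
    · exact (min_le_right _ _).trans (min_le_left _ _)
    · exact (min_le_right _ _).trans (min_le_right _ _)
  refine ⟨ε, hε, fun f₁ f₂ ℓ₁ ℓ₂ h₁ h₂ hl₁ hl₂ τ hτ => ?_⟩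
  suffices h : ∃ σ, |σ - τ| ≤ 3 * ε ∧ dist (f₁ τ) (f₂ σ) ≤ 2 * (η / 7) + 2 * ε by
    obtain ⟨σ, hσ, hdist⟩ := h
    have := h₂.lipschitz.dist_le_abs_sub σ τ
    linarith [dist_triangle (f₁ τ) (f₂ σ) (f₂ τ)]
  have hτℓ : τ ≤ ℓ₁ := hτ.2.trans h₁.dist_le
  have hclose : ∀ {a b}, a ∈ Set.Icc 0 ℓ₁ → b ∈ Set.Icc 0 ℓ₂ → f₁ a = f₂ b → |a - b| ≤ ε :=
    fun ha hb hab => h₁.toIsCurve.abs_sub_le h₂.toIsCurve hl₁ hl₂ ha hb hab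
  set F := f₂ '' Set.Icc 0 ℓ₂ with hF
  have hFc : IsClosed (f₁ ⁻¹' F) :=
    (isCompact_Icc.image h₂.lipschitz.continuous).isClosed.preimage h₁.lipschitz.continuous
  by_cases hτF : f₁ τ ∈ F
  · obtain ⟨σ, hσ, he⟩ := hτF
    refine ⟨σ, ?_, ?_⟩
    · have := hclose ⟨hτ.1, hτℓ⟩ hσ he.symm
      rw [abs_sub_comm]; linarith
    · rw [he, dist_self]; linarith
  obtain ⟨a₁, ⟨⟨ha0, haτ⟩, a₂, ha₂, hae⟩, hagr⟩ :=
    ((isCompact_Icc (a := 0) (b := τ)).inter_right hFc).exists_isGreatest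
      ⟨0, ⟨le_rfl, hτ.1⟩, 0, ⟨le_rfl, h₂.nonneg⟩, by rw [h₁.source, h₂.source]⟩
  obtain ⟨b₁, ⟨⟨hbτ, hbℓ⟩, b₂, hb₂, hbe⟩, hble⟩ :=
    ((isCompact_Icc (a := τ) (b := ℓ₁)).inter_right hFc).exists_isLeast
      ⟨ℓ₁, ⟨hτℓ, le_rfl⟩, ℓ₂, ⟨h₂.nonneg, le_rfl⟩, by rw [h₁.target, h₂.target]⟩
  have haτ' : a₁ < τ := haτ.lt_of_ne (by rintro rfl; exact hτF ⟨a₂, ha₂, hae⟩)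
  have hbτ' : τ < b₁ := hbτ.lt_of_ne (by rintro rfl; exact hτF ⟨b₂, hb₂, hbe⟩)
  have hab : a₁ < b₁ := haτ'.trans hbτ'
  have hac := abs_le.1 (hclose ⟨ha0, haτ.trans hτℓ⟩ ha₂ hae.symm)
  have hbc := abs_le.1 (hclose ⟨hτ.1.trans hbτ, hbℓ⟩ hb₂ hbe.symm)
  have hout : ∀ t, a₁ < t → t < b₁ → f₁ t ∉ F := by
    intro t h1 h2 h3
    rcases le_total t τ with h | h
    · exact h1.not_ge (hagr ⟨⟨ha0.trans h1.le, h⟩, h3⟩)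
    · exact h2.not_ge (hble ⟨⟨h, h2.le.trans hbℓ⟩, h3⟩)
  -- If f₂ meets the endpoints of the excursion in the reverse order, the excursion lasts at most 2ε
  -- and no loop is needed.
  rcases le_or_gt b₂ a₂ with h21 | h21
  · refine ⟨a₂, abs_le.2 ⟨by linarith, by linarith⟩, ?_⟩
    rw [hae]
    have := h₁.lipschitz.dist_le_abs_sub τ a₁
    rw [abs_of_nonneg (by linarith)] at this
    linarith
  have lip1 : LipschitzWith 1 fun t => f₁ (a₁ + t) := lipschitzWith_one_of_le fun s t hst => by
    refine (h₁.lipschitz.dist_le_abs_sub _ _).trans ?_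
    rw [abs_sub_comm, abs_of_nonneg (by linarith)]; linarith
  have lip2 : LipschitzWith 1 fun t => f₂ (b₂ - t) := lipschitzWith_one_of_le fun s t hst => by
    refine (h₂.lipschitz.dist_le_abs_sub _ _).trans ?_
    rw [abs_of_nonneg (by linarith)]; linarith
  set l₁ := b₁ - a₁ with hl₁def
  set l₂ := b₂ - a₂ with hl₂def
  have l₁le : l₁ ≤ L := by linarith
  have l₂le : l₂ ≤ L := by linarith [ha₂.1, hb₂.2]
  have hglip := concatAt_lipschitzWith (a := l₁) lip1 lip2
    (by simp only [hl₁def, add_sub_cancel, sub_zero, hbe])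
  obtain ⟨Y, _, P, c, hY, hP, hPc, hc, hc0⟩ := hmaj.exists_lift
    (g := concatAt (fun t => f₁ (a₁ + t)) l₁ fun t => f₂ (b₂ - t)) (T := l₁ + l₂) (by linarith)
    (by linarith) hglip.lipschitzOnWith
    (by
      rw [concatAt_of_lt (by linarith), concatAt_of_le (by linarith), add_zero,
        add_sub_cancel_left, hl₂def, sub_sub_cancel, hae])
    (by
      refine concatAt_injOn (fun s hs t ht hst => ?_) (fun s hs t ht hst => ?_)
        fun s hs t ht hst => ?_
      · have := h₁.injOn ⟨by linarith [hs.1], by linarith [hs.2]⟩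
          ⟨by linarith [ht.1], by linarith [ht.2]⟩ hst
        linarith
      · have := h₂.injOn ⟨by linarith [hs.2, ha₂.1], by linarith [hs.1, hb₂.2]⟩
          ⟨by linarith [ht.2, ha₂.1], by linarith [ht.1, hb₂.2]⟩ hst
        linarith
      · have hmem : b₂ - t ∈ Set.Icc 0 ℓ₂ := ⟨by linarith [ht.2, ha₂.1], by linarith [ht.1, hb₂.2]⟩
        rcases hs.1.eq_or_lt with rfl | hs0
        · rw [add_zero, ← hae] at hst
          have := h₂.injOn ha₂ hmem hst
          linarith [ht.2]
        · exact hout (a₁ + s) (by linarith) (by linarith [hs.2]) ⟨_, hmem, hst.symm⟩)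
  have PA : P (c 0) = f₁ a₁ := by
    rw [hPc 0 ⟨le_rfl, by linarith⟩, concatAt_of_lt (by linarith), add_zero]
  have PB : P (c l₁) = f₁ b₁ := by
    rw [hPc l₁ ⟨by linarith, by linarith⟩, concatAt_of_le le_rfl, sub_self, sub_zero, hbe]
  have hD1 : dist (c 0) (c l₁) ≤ l₁ := by linarith [hc 0 l₁ le_rfl (by linarith) (by linarith)]
  have hD2 : dist (c 0) (c l₁) ≤ l₂ := by
    rw [hc0, dist_comm]; linarith [hc l₁ (l₁ + l₂) (by linarith) (by linarith) le_rfl]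
  -- P is 1-Lipschitz and f₁ is almost shortest, so the lifted endpoints cannot be much closer than
  -- the arc between them is long.
  have hD3 : l₁ - ε ≤ dist (c 0) (c l₁) := by
    have e1 := hP.dist_le_mul (c 0) (c l₁)
    rw [PA, PB, NNReal.coe_one, one_mul] at e1
    have e2 := h₁.dist_source ha0
    have e3 := h₁.dist_target hbℓ
    linarith [dist_triangle4 p (f₁ a₁) (f₁ b₁) q]
  set D := dist (c 0) (c l₁) with hD
  have hD0 : 0 ≤ D := dist_nonneg
  obtain ⟨ρ, hρ⟩ := hY.geodesic (c 0) (c l₁) fun hκ => by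
    have := hL hκ
    linarith
  -- Both points of the loop are compared with the point of the geodesic `ρ` at time `w`; the
  -- minimum keeps it on `ρ` and changes the time by at most ε.
  set w := min (τ - a₁) D with hw
  have hw0 : 0 ≤ w := le_min (by linarith) hD0
  have hwD : w ≤ D := min_le_right _ _
  have hw1 : w ≤ τ - a₁ := min_le_left _ _
  have hw2 : τ - a₁ ≤ w + ε := by
    rcases min_cases (τ - a₁) D with h | h <;> linarith
  have near : ∀ y : Y, dist y (c 0) ≤ w + 3 * ε → dist y (c l₁) ≤ (D - w) + 3 * ε →
      dist y (c 0) + dist y (c l₁) ≤ L → dist y (ρ w) ≤ η / 7 := by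
    intro y hy1 hy2 hy3
    obtain ⟨m, hm1, hm2, hm3, hm4⟩ := hY.exists_cevian hρ y hw0 (sub_nonneg.2 hwD) (by ring)
      fun hκ => by
        have := hL hκ
        linarith
    exact hm1.trans (hbound (3 * ε) (by linarith) hε1 w (D - w) _ _ m hw0 (by linarith)
      dist_nonneg dist_nonneg (by linarith) hy1 hy2 hm2 hm3 hm4.le)
  set σ := max a₂ (min τ b₂) with hσ
  have hσ1 : a₂ ≤ σ := le_max_left _ _
  have hσ2 : σ ≤ b₂ := max_le h21.le (min_le_right _ _)
  have hσ3 : |σ - τ| ≤ ε := by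
    rw [abs_le]
    rcases max_cases a₂ (min τ b₂) with h | h <;> rcases min_cases τ b₂ with h' | h' <;>
      constructor <;> linarith
  have hσ4 := abs_le.1 hσ3
  refine ⟨σ, by linarith, ?_⟩
  have n1 := near (c (τ - a₁))
    (by rw [dist_comm]; linarith [hc 0 (τ - a₁) le_rfl (by linarith) (by linarith)])
    (by linarith [hc (τ - a₁) l₁ (by linarith) (by linarith) (by linarith)])
    (by
      rw [dist_comm]
      linarith [hc 0 (τ - a₁) le_rfl (by linarith) (by linarith),
        hc (τ - a₁) l₁ (by linarith) (by linarith) (by linarith)])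
  have z1 := hc l₁ (l₁ + (b₂ - σ)) (by linarith) (by linarith) (by linarith)
  have z2 := hc (l₁ + (b₂ - σ)) (l₁ + l₂) (by linarith) (by linarith) (by linarith)
  rw [← hc0] at z2
  rw [dist_comm] at z1
  have n2 := near (c (l₁ + (b₂ - σ))) (by linarith) (by linarith) (by linarith)
  have P1 : P (c (τ - a₁)) = f₁ τ := by
    rw [hPc _ ⟨by linarith, by linarith⟩, concatAt_of_lt (by linarith), add_sub_cancel]
  have P2 : P (c (l₁ + (b₂ - σ))) = f₂ σ := by
    rw [hPc _ ⟨by linarith, by linarith⟩, concatAt_of_le (by linarith), add_sub_cancel_left,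
      sub_sub_cancel]
  have e1 := hP.dist_le_mul (c (τ - a₁)) (c (l₁ + (b₂ - σ)))
  rw [P1, P2, NNReal.coe_one, one_mul] at e1
  linarith [dist_triangle_right (c (τ - a₁)) (c (l₁ + (b₂ - σ))) (ρ w)]

theorem MajorizedByCAT.exists_geodesic [CompleteSpace X] (hX : IsLengthSpace X)
    (hmaj : MajorizedByCAT.{u, v} κ Λ X) (hκΛ : 0 < κ → Λ ≤ Real.pi / √κ) {p q : X}
    (hpq : dist p q < Λ) : ∃ γ : ℝ → X, IsGeodesicBetween γ p q := by
  choose f ℓ hf hℓ using fun n : ℕ => hX.exists_isArc p q (Nat.one_div_pos_of_nat (α := ℝ) (n := n))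
  have hlim0 : Filter.Tendsto (fun n : ℕ => 1 / ((n : ℝ) + 1)) Filter.atTop (nhds 0) :=
    tendsto_one_div_add_atTop_nhds_zero_nat
  have hex : ∀ t, ∃ x, t ∈ Set.Icc 0 (dist p q) →
      Filter.Tendsto (fun n => f n t) Filter.atTop (nhds x) := by
    intro t
    by_cases ht : t ∈ Set.Icc 0 (dist p q)
    · have : CauchySeq fun n => f n t := by
        refine Metric.cauchySeq_iff'.2 fun η hη => ?_
        obtain ⟨ε, hε, h⟩ := hmaj.arcs_close hκΛ hpq (half_pos hη)
        obtain ⟨N, hN⟩ := Filter.eventually_atTop.1 (hlim0.eventually (gt_mem_nhds hε))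
        refine ⟨N, fun n hn => (h _ _ _ _ (hf n) (hf N) ?_ ?_ t ht).trans_lt (half_lt_self hη)⟩
        · exact (hℓ n).trans (by linarith [hN n hn])
        · exact (hℓ N).trans (by linarith [hN N le_rfl])
      obtain ⟨x, hx⟩ := cauchySeq_tendsto_of_complete this
      exact ⟨x, fun _ => hx⟩
    · exact ⟨p, fun h => absurd h ht⟩
  choose γ hγ using hex
  have hd : (0 : ℝ) ≤ dist p q := dist_nonneg
  refine ⟨γ, isGeodesicBetween_of_dist_le ?_ ?_ fun s t hs hst ht => ?_⟩
  · refine tendsto_nhds_unique (hγ 0 ⟨le_rfl, hd⟩) ?_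
    simp only [(hf _).source, tendsto_const_nhds]
  · refine tendsto_nhds_unique (hγ _ ⟨hd, le_rfl⟩) (tendsto_iff_dist_tendsto_zero.2 ?_)
    refine squeeze_zero (fun _ => dist_nonneg) (fun n => ?_) hlim0
    have := (hf n).dist_target (hf n).dist_le
    linarith [hℓ n]
  · refine le_of_tendsto ((hγ s ⟨hs, hst.trans ht⟩).dist (hγ t ⟨hs.trans hst, ht⟩))
      (Filter.Eventually.of_forall fun n => ?_)
    have := (hf n).lipschitz.dist_le_abs_sub s t
    rwa [abs_sub_comm, abs_of_nonneg (by linarith)] at this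

end Geodesics

/-! ### Stewart's inequality in X -/

section Stewart

variable {X : Type u} [MetricSpace X] {κ Λ : ℝ}

theorem IsGeodesicBetween.congr {γ f : ℝ → X} {p q : X} (h : IsGeodesicBetween γ p q)
    (hf : Set.EqOn f γ (Set.Icc 0 (dist p q))) : IsGeodesicBetween f p q where
  source := (hf ⟨le_rfl, dist_nonneg⟩).trans h.source
  target := (hf ⟨dist_nonneg, le_rfl⟩).trans h.target
  isometric s hs t ht := by rw [hf hs, hf ht, h.isometric s hs t ht]

theorem IsGeodesicBetween.exists_lipschitz {γ : ℝ → X} {p q : X} (h : IsGeodesicBetween γ p q) :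
    ∃ f, LipschitzWith 1 f ∧ IsGeodesicBetween f p q ∧ Set.EqOn f γ (Set.Icc 0 (dist p q)) := by
  obtain ⟨f, hf, he⟩ := h.isArc
  exact ⟨f, hf.lipschitz, h.congr he, he⟩

theorem IsGeodesicBetween.dist_source {γ : ℝ → X} {p q : X} (h : IsGeodesicBetween γ p q) {t : ℝ}
    (ht : t ∈ Set.Icc 0 (dist p q)) : dist p (γ t) = t := by
  have := h.isometric 0 ⟨le_rfl, dist_nonneg⟩ t ht
  rwa [h.source, zero_sub, abs_neg, abs_of_nonneg ht.1] at this

theorem IsGeodesicBetween.dist_target {γ : ℝ → X} {p q : X} (h : IsGeodesicBetween γ p q) {t : ℝ}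
    (ht : t ∈ Set.Icc 0 (dist p q)) : dist (γ t) q = dist p q - t := by
  have := h.isometric t ht _ ⟨dist_nonneg, le_rfl⟩
  rwa [h.target, abs_sub_comm, abs_of_nonneg (by linarith [ht.2])] at this

theorem IsGeodesicBetween.dist_eq_sub {γ : ℝ → X} {p q : X} (h : IsGeodesicBetween γ p q)
    {s t : ℝ} (hs : 0 ≤ s) (hst : s ≤ t) (ht : t ≤ dist p q) : dist (γ s) (γ t) = t - s := by
  rw [h.isometric s ⟨hs, hst.trans ht⟩ t ⟨hs.trans hst, ht⟩, abs_sub_comm,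
    abs_of_nonneg (by linarith)]

/-- The comparison inequality for a triangle with sides `σ`, `γ|[a, c]`, `ρ`, in which `σ` and
`ρ` may share an initial segment, but which is simple otherwise. -/
theorem MajorizedByCAT.stewartLE_of_simple (hmaj : MajorizedByCAT.{u, v} κ Λ X)
    (hκΛ : 0 < κ → Λ ≤ Real.pi / √κ) {q : X} {γ σ ρ : ℝ → X} {a b c : ℝ} (hab : a < b) (hbc : b < c)
    (hγ : LipschitzWith 1 γ) (hσ : LipschitzWith 1 σ) (hρ : LipschitzWith 1 ρ)
    (hγi : ∀ s t, a ≤ s → s ≤ t → t ≤ c → dist (γ s) (γ t) = t - s)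
    (hσg : IsGeodesicBetween σ q (γ a)) (hρg : IsGeodesicBetween ρ q (γ c))
    (hσγ : ∀ t, a < t → t ≤ c → ∀ u ∈ Set.Icc 0 (dist q (γ a)), σ u ≠ γ t)
    (hργ : ∀ t, a ≤ t → t < c → ∀ u ∈ Set.Icc 0 (dist q (γ c)), ρ u ≠ γ t)
    (hper : dist q (γ a) + dist q (γ c) + (c - a) < 2 * Λ) :
    StewartLE κ (dist q (γ a)) (dist q (γ c)) (b - a) (c - b) (dist q (γ b)) := by
  have hla : 0 ≤ dist q (γ a) := dist_nonneg
  have hlc : 0 ≤ dist q (γ c) := dist_nonneg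
  have hl2 := hγi a c le_rfl (hab.trans hbc).le le_rfl
  have tr1 := dist_triangle q (γ c) (γ a)
  have tr2 := dist_triangle q (γ a) (γ c)
  have tr5 := dist_triangle_left (γ a) (γ c) q
  rw [dist_comm (γ c)] at tr1
  set la := dist q (γ a) with hladef
  set lc := dist q (γ c) with hlcdef
  -- `e` is the last time at which `σ` and `ρ` agree. As both are parametrized by the distance from
  -- q, they can only meet at equal times; after `e` they are disjoint.
  obtain ⟨e, ⟨⟨he0, hemin⟩, hee⟩, hegr⟩ := ((isCompact_Icc (a := 0) (b := min la lc)).inter_right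
    (isClosed_eq hσ.continuous hρ.continuous)).exists_isGreatest
    ⟨0, ⟨le_rfl, le_min hla hlc⟩, by
      change σ 0 = ρ 0
      rw [hσg.source, hρg.source]⟩
  have hee' : σ e = ρ e := hee
  have hmeet : ∀ s ∈ Set.Icc 0 la, ∀ t ∈ Set.Icc 0 lc, σ s = ρ t → s = t ∧ s ≤ e := by
    intro s hs t ht hst
    have h1 := hσg.dist_source hs
    have h2 := hρg.dist_source ht
    rw [hst, h2] at h1
    subst h1
    exact ⟨rfl, hegr ⟨⟨hs.1, le_min hs.2 ht.2⟩, hst⟩⟩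
  have hela : e < la := by
    refine (hemin.trans (min_le_left _ _)).lt_of_ne fun h => ?_
    refine hργ a le_rfl (hab.trans hbc) e ⟨he0, hemin.trans (min_le_right _ _)⟩ ?_
    rw [← hee', h, hσg.target]
  have helc : e < lc := by
    refine (hemin.trans (min_le_right _ _)).lt_of_ne fun h => ?_
    refine hσγ c (hab.trans hbc) le_rfl e ⟨he0, hela.le⟩ ?_
    rw [hee', h, hρg.target]
  have lip1 : LipschitzWith 1 fun t => σ (e + t) := lipschitzWith_one_of_le fun s t hst => by
    refine (hσ.dist_le_abs_sub _ _).trans ?_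
    rw [abs_sub_comm, abs_of_nonneg (by linarith)]; linarith
  have lip2 : LipschitzWith 1 fun t => γ (a + t) := lipschitzWith_one_of_le fun s t hst => by
    refine (hγ.dist_le_abs_sub _ _).trans ?_
    rw [abs_sub_comm, abs_of_nonneg (by linarith)]; linarith
  have lip3 : LipschitzWith 1 fun t => ρ (lc - t) := lipschitzWith_one_of_le fun s t hst => by
    refine (hρ.dist_le_abs_sub _ _).trans ?_
    rw [abs_of_nonneg (by linarith)]; linarith
  set l₁ := la - e with hl₁
  set l₂ := c - a with hl₂
  set l₃ := lc - e with hl₃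
  have hlip23 := concatAt_lipschitzWith (a := l₂) lip2 lip3
    (by simp only [hl₂, add_sub_cancel, sub_zero, hlcdef, hρg.target])
  have hlip := concatAt_lipschitzWith (a := l₁) lip1 hlip23
    (by
      rw [concatAt_of_lt (by linarith)]
      simp only [hl₁, add_sub_cancel, add_zero, hladef, hσg.target])
  obtain ⟨Y, _, P, κY, hY, hP, hPc, hc, hc0⟩ := hmaj.exists_lift
    (g := concatAt (fun t => σ (e + t)) l₁
      (concatAt (fun t => γ (a + t)) l₂ fun t => ρ (lc - t)))
    (T := l₁ + (l₂ + l₃)) (by linarith) (by linarith) hlip.lipschitzOnWith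
    (by
      rw [concatAt_of_lt (by linarith), concatAt_of_le (by linarith), add_sub_cancel_left,
        concatAt_of_le (by linarith), add_sub_cancel_left, add_zero, hl₃, sub_sub_cancel, hee'])
    (by
      refine concatAt_injOn (fun s hs t ht hst => ?_) (concatAt_injOn (fun s hs t ht hst => ?_)
        (fun s hs t ht hst => ?_) fun s hs t ht hst => ?_) fun s hs t ht hst => ?_
      · have h1 := hσg.dist_source (t := e + s) ⟨by linarith [hs.1], by linarith [hs.2]⟩
        have h2 := hσg.dist_source (t := e + t) ⟨by linarith [ht.1], by linarith [ht.2]⟩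
        rw [hst] at h1
        linarith
      · rcases le_total s t with h | h
        · have := hγi (a + s) (a + t) (by linarith [hs.1]) (by linarith) (by linarith [ht.2])
          rw [hst, dist_self] at this
          linarith
        · have := hγi (a + t) (a + s) (by linarith [ht.1]) (by linarith) (by linarith [hs.2])
          rw [hst, dist_self] at this
          linarith
      · have h1 := hρg.dist_source (t := lc - s) ⟨by linarith [hs.2], by linarith [hs.1]⟩
        have h2 := hρg.dist_source (t := lc - t) ⟨by linarith [ht.2], by linarith [ht.1]⟩
        rw [hst] at h1
        linarith
      · exact hργ (a + s) (by linarith [hs.1]) (by linarith [hs.2]) (lc - t)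
          ⟨by linarith [ht.2], by linarith [ht.1]⟩ hst.symm
      · have hes : e + s ∈ Set.Icc 0 la := ⟨by linarith [hs.1], by linarith [hs.2]⟩
        rcases lt_or_ge t l₂ with h | h
        · rw [concatAt_of_lt h] at hst
          rcases ht.1.eq_or_lt with rfl | h0
          · have := hσg.dist_source hes
            rw [hst, add_zero, ← hladef] at this
            linarith [hs.2]
          · exact hσγ (a + t) (by linarith) (by linarith) (e + s) hes hst
        · rw [concatAt_of_le h] at hst
          obtain ⟨h1, h2⟩ := hmeet _ hes (lc - (t - l₂)) ⟨by linarith [ht.2], by linarith⟩ hst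
          linarith [ht.2])
  have P0 : P (κY 0) = σ e := by
    rw [hPc 0 ⟨le_rfl, by linarith⟩, concatAt_of_lt (by linarith), add_zero]
  have P2 : ∀ t, 0 ≤ t → t ≤ l₂ → P (κY (l₁ + t)) = γ (a + t) := by
    intro t h0 h1
    rw [hPc _ ⟨by linarith, by linarith⟩, concatAt_of_le (by linarith), add_sub_cancel_left]
    rcases h1.eq_or_lt with rfl | h1
    · rw [concatAt_of_le le_rfl, sub_self, sub_zero, hl₂, add_sub_cancel, hlcdef, hρg.target]
    · rw [concatAt_of_lt h1]
  have hPd : ∀ y z, dist (P y) (P z) ≤ dist y z := fun y z => by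
    simpa using hP.dist_le_mul y z
  -- For each side the lift is no longer than the side, and P does not increase distances, so the
  -- lifted triangle has exactly the same side lengths.
  have dQA : dist (κY 0) (κY (l₁ + 0)) = l₁ := by
    refine le_antisymm (by linarith [hc 0 (l₁ + 0) le_rfl (by linarith) (by linarith)]) ?_
    have := hPd (κY 0) (κY (l₁ + 0))
    rw [P0, P2 0 le_rfl (by linarith), add_zero a,
      hσg.dist_target (t := e) ⟨he0, hela.le⟩] at this
    exact this
  have dAC : dist (κY (l₁ + 0)) (κY (l₁ + l₂)) = l₂ := by
    refine le_antisymm (by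
      linarith [hc (l₁ + 0) (l₁ + l₂) (by linarith) (by linarith) (by linarith)]) ?_
    have := hPd (κY (l₁ + 0)) (κY (l₁ + l₂))
    rw [P2 0 le_rfl (by linarith), P2 l₂ (by linarith) le_rfl, add_zero a,
      hγi a (a + l₂) le_rfl (by linarith) (by linarith)] at this
    linarith
  have dQC : dist (κY 0) (κY (l₁ + l₂)) = l₃ := by
    refine le_antisymm (by
      rw [hc0, dist_comm]
      linarith [hc (l₁ + l₂) (l₁ + (l₂ + l₃)) (by linarith) (by linarith) (by linarith)]) ?_
    have := hPd (κY 0) (κY (l₁ + l₂))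
    rw [P0, P2 l₂ (by linarith) le_rfl, hl₂, add_sub_cancel, hee',
      hρg.dist_target (t := e) ⟨he0, helc.le⟩] at this
    exact this
  have hgeo : IsGeodesicBetween (fun t => κY (l₁ + t)) (κY (l₁ + 0)) (κY (l₁ + l₂)) := by
    refine isGeodesicBetween_of_dist_le rfl (by rw [dAC]) fun s t hs hst ht => ?_
    rw [dAC] at ht
    linarith [hc (l₁ + s) (l₁ + t) (by linarith) (by linarith) (by linarith)]
  obtain ⟨w, hw1, hw2, hw3, hw4⟩ := hY.exists_cevian hgeo (κY 0) (s := b - a) (t := c - b)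
    (by linarith) (by linarith) (by rw [dAC]; linarith) fun hκ => by
      have := hκΛ hκ
      rw [dQA, dQC]
      linarith
  have tr3 := dist_triangle (κY 0) (κY (l₁ + l₂)) (κY (l₁ + 0))
  have tr4 := dist_triangle (κY 0) (κY (l₁ + 0)) (κY (l₁ + l₂))
  rw [dist_comm (κY (l₁ + l₂)) (κY (l₁ + 0))] at tr3
  rw [dQA, dQC] at hw2 hw4
  have hdb : dist q (γ b) ≤ e + w := by
    have h1 := hPd (κY 0) (κY (l₁ + (b - a)))
    rw [P0, P2 (b - a) (by linarith) (by linarith), add_sub_cancel] at h1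
    have h2 := hσg.dist_source (t := e) ⟨he0, hela.le⟩
    have h3 := dist_triangle q (σ e) (γ b)
    have h4 : dist (κY 0) (κY (l₁ + (b - a))) ≤ w := hw1
    linarith
  have := stewartLE_of_tail (κ := κ) he0 (a := l₁) (c := l₃) (s := b - a) (t := c - b) (u := w)
    (by linarith) (by linarith) (by linarith) (by linarith) dist_nonneg hdb
    (abs_le.2 ⟨by linarith, by linarith⟩) (fun hκ => by have := hκΛ hκ; linarith)
    (fun hκ => by have := hκΛ hκ; linarith) (fun hκ => by have := hκΛ hκ; linarith)
    (fun hκ => by have := hκΛ hκ; linarith) hw4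
  rwa [hl₁, hl₃, add_sub_cancel, add_sub_cancel] at this

/-- The points γ a and γ c are pushed towards γ b as long as γ follows a shortest path to q from γ(b
- δ) and γ(b + δ) respectively. If one reaches b, the kink inequality applies; otherwise any
geodesics from q to γ a and γ c meet γ between a and c only at their own endpoints. -/
theorem MajorizedByCAT.exists_stewartLE [CompleteSpace X] (hX : IsLengthSpace X)
    (hmaj : MajorizedByCAT.{u, v} κ Λ X) (hκΛ : 0 < κ → Λ ≤ Real.pi / √κ) {p q r : X}
    {γ : ℝ → X} (hγl : LipschitzWith 1 γ) (hγ : IsGeodesicBetween γ p r) (hpr : dist p r < Λ)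
    {b : ℝ} (hb : b ∈ Set.Ioo 0 (dist p r)) (hqb : dist q (γ b) < Λ) :
    ∃ s t, 0 < s ∧ 0 < t ∧ 0 ≤ b - s ∧ b + t ≤ dist p r ∧
      StewartLE κ (dist q (γ (b - s))) (dist q (γ (b + t))) s t (dist q (γ b)) := by
  have hγd : ∀ s t, 0 ≤ s → s ≤ t → t ≤ dist p r → dist (γ s) (γ t) = t - s :=
    fun s t => hγ.dist_eq_sub
  set d : ℝ → ℝ := fun t => dist q (γ t) with hd
  have hdc : Continuous d := continuous_const.dist hγl.continuous
  have hlip1 : ∀ s t, 0 ≤ s → s ≤ t → t ≤ dist p r → d s ≤ d t + (t - s) := by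
    intro s t hs hst ht
    have := dist_triangle q (γ t) (γ s)
    rwa [dist_comm (γ t), hγd s t hs hst ht] at this
  have hlip2 : ∀ s t, 0 ≤ s → s ≤ t → t ≤ dist p r → d t ≤ d s + (t - s) := by
    intro s t hs hst ht
    have := dist_triangle q (γ s) (γ t)
    rwa [hγd s t hs hst ht] at this
  have hlip3 : ∀ s t, 0 ≤ s → s ≤ t → t ≤ dist p r → t - s ≤ d s + d t := by
    intro s t hs hst ht
    have := dist_triangle_left (γ s) (γ t) q
    rwa [hγd s t hs hst ht] at this
  have hm0 : 0 ≤ d b := dist_nonneg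
  have hmΛ : d b < Λ := hqb
  have hb1 := hb.1
  have hb2 := hb.2
  -- The third bound makes the perimeter of the triangle, at most 2 d(b) + 4δ, less than 2Λ.
  obtain ⟨δ, hδ, hδ1, hδ2, hδ3⟩ : ∃ δ > 0, δ ≤ b ∧ δ ≤ dist p r - b ∧ δ ≤ (Λ - d b) / 3 := by
    refine ⟨min b (min (dist p r - b) ((Λ - d b) / 3)), ?_, min_le_left _ _, ?_, ?_⟩
    · exact lt_min hb1 (lt_min (by linarith) (by linarith))
    · exact (min_le_right _ _).trans (min_le_left _ _)
    · exact (min_le_right _ _).trans (min_le_right _ _)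
  obtain ⟨a, ⟨⟨ha0, hab⟩, hae⟩, hagr⟩ := ((isCompact_Icc (a := b - δ) (b := b)).inter_right
    (isClosed_eq (f := fun t => d t + (t - (b - δ))) (g := fun _ => d (b - δ)) (by fun_prop)
      (by fun_prop))).exists_isGreatest ⟨b - δ, ⟨le_rfl, by linarith⟩, by simp⟩
  obtain ⟨c, ⟨⟨hbc, hc0⟩, hce⟩, hcle⟩ := ((isCompact_Icc (a := b) (b := b + δ)).inter_right
    (isClosed_eq (f := fun t => d t + (b + δ - t)) (g := fun _ => d (b + δ)) (by fun_prop)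
      (by fun_prop))).exists_isLeast ⟨b + δ, ⟨by linarith, le_rfl⟩, by simp⟩
  have hae' : d a + (a - (b - δ)) = d (b - δ) := hae
  have hce' : d c + (b + δ - c) = d (b + δ) := hce
  have w1 : WithinDiam κ δ := fun hκ => by have := hκΛ hκ; linarith
  rcases hab.eq_or_lt with rfl | hab
  · refine ⟨δ, δ, hδ, hδ, by linarith, by linarith, ?_⟩
    have h1 := hlip1 a (a + δ) (by linarith) (by linarith) (by linarith)
    have h2 := hlip2 a (a + δ) (by linarith) (by linarith) (by linarith)
    have h3 := hlip3 a (a + δ) (by linarith) (by linarith) (by linarith)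
    have := stewartLE_of_kink (κ := κ) (s := δ) (t := δ) (m := d a) (c := d (a + δ)) hδ.le w1
      (fun hκ => by have := hκΛ hκ; linarith) (abs_le.2 ⟨by linarith, by linarith⟩)
    rwa [show d a + δ = d (a - δ) by linarith] at this
  rcases hbc.eq_or_lt with rfl | hbc
  · refine ⟨δ, δ, hδ, hδ, by linarith, by linarith, ?_⟩
    have h1 := hlip1 (b - δ) b (by linarith) (by linarith) (by linarith)
    have h2 := hlip2 (b - δ) b (by linarith) (by linarith) (by linarith)
    have h3 := hlip3 (b - δ) b (by linarith) (by linarith) (by linarith)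
    have := stewartLE_of_kink (κ := κ) (s := δ) (t := δ) (m := d b) (c := d (b - δ)) hδ.le w1
      (fun hκ => by have := hκΛ hκ; linarith) (abs_le.2 ⟨by linarith, by linarith⟩)
    rw [show d b + δ = d (b + δ) by linarith] at this
    exact this.symm
  have la := hlip1 a b (by linarith) hab.le (by linarith)
  have lc := hlip2 b c (by linarith) hbc.le (by linarith)
  obtain ⟨σ₀, hσ₀⟩ := hmaj.exists_geodesic hX hκΛ (p := q) (q := γ a) (by
    change d a < Λ
    linarith)
  obtain ⟨ρ₀, hρ₀⟩ := hmaj.exists_geodesic hX hκΛ (p := q) (q := γ c) (by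
    change d c < Λ
    linarith)
  obtain ⟨σ, hσl, hσ, -⟩ := hσ₀.exists_lipschitz
  obtain ⟨ρ, hρl, hρ, -⟩ := hρ₀.exists_lipschitz
  have key := hmaj.stewartLE_of_simple hκΛ hab hbc hγl hσl hρl
    (fun s t hs hst ht => hγd s t (by linarith) hst (by linarith)) hσ hρ
    -- If the geodesic to γ a met γ t for some t > a, then t (if t ≤ b) or b (if t ≥ b) would
    -- satisfy the equation that defines `a` as its greatest solution.
    (fun t hat htc u hu he => by
      have h1 : d t = u := by rw [← hσ.dist_source hu, he]
      have h2 := hσ.dist_target hu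
      rw [he, dist_comm, hγd a t (by linarith) hat.le (by linarith)] at h2
      have h2' : t - a = d a - u := h2
      rcases le_total t b with htb | htb
      · exact hat.not_ge (hagr ⟨⟨by linarith, htb⟩, by
          change d t + (t - (b - δ)) = d (b - δ)
          linarith⟩)
      · have h3 := hlip2 b t (by linarith) htb (by linarith)
        have h4 := hlip1 (b - δ) b (by linarith) (by linarith) (by linarith)
        have h5 := hlip1 b t (by linarith) htb (by linarith)
        exact hab.not_ge (hagr ⟨⟨by linarith, le_rfl⟩, by
          change d b + (b - (b - δ)) = d (b - δ)
          linarith⟩))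
    (fun t hat htc u hu he => by
      have h1 : d t = u := by rw [← hρ.dist_source hu, he]
      have h2 := hρ.dist_target hu
      rw [he, hγd t c (by linarith) htc.le (by linarith)] at h2
      have h2' : c - t = d c - u := h2
      rcases le_total b t with htb | htb
      · exact htc.not_ge (hcle ⟨⟨htb, by linarith⟩, by
          change d t + (b + δ - t) = d (b + δ)
          linarith⟩)
      · have h4 := hlip2 b (b + δ) (by linarith) (by linarith) (by linarith)
        have h5 := hlip2 t b (by linarith) htb (by linarith)
        exact hbc.not_ge (hcle ⟨⟨le_rfl, by linarith⟩, by
          change d b + (b + δ - b) = d (b + δ)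
          linarith⟩))
    (by
      change d a + d c + (c - a) < 2 * Λ
      linarith)
  refine ⟨b - a, c - b, by linarith, by linarith, by linarith, by linarith, ?_⟩
  rwa [sub_sub_cancel, add_sub_cancel]

/-- The comparison inequality for a vertex `q` and the opposite side `γ` all of whose points are
at distance less than `Λ` from `q`. -/
theorem MajorizedByCAT.stewartLE [CompleteSpace X] (hX : IsLengthSpace X)
    (hmaj : MajorizedByCAT.{u, v} κ Λ X) (hκΛ : 0 < κ → Λ ≤ Real.pi / √κ) {p q r : X}
    {γ : ℝ → X} (hγ : IsGeodesicBetween γ p r) (hpr : dist p r < Λ)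
    (hq : ∀ t ∈ Set.Icc 0 (dist p r), dist q (γ t) < Λ) {b : ℝ} (hb : b ∈ Set.Icc 0 (dist p r)) :
    StewartLE κ (dist q p) (dist q r) b (dist p r - b) (dist q (γ b)) := by
  obtain ⟨f, hfl, hf, hfe⟩ := hγ.exists_lipschitz
  rw [← hfe hb]
  have hqf : ∀ t ∈ Set.Icc 0 (dist p r), dist q (f t) < Λ := fun t ht => hfe ht ▸ hq t ht
  have hfs := hf.source
  have hft := hf.target
  rcases (dist_nonneg (x := p) (y := r)).eq_or_lt with h0 | h0
  · have : b = 0 := le_antisymm (hb.2.trans h0.ge) hb.1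
    simp [StewartLE, this, ← h0, modelSin_zero]
  set L := dist p r with hL
  have hcont : Continuous fun t => modelVer κ (dist q (f t)) - modelVer κ t :=
    (continuous_modelVer.comp (continuous_const.dist hfl.continuous)).sub continuous_modelVer
  -- Along a line v satisfies Stewart's identity exactly; subtracting v(t) turns the local
  -- inequality into the homogeneous one.
  have := modelSin_convex_of_local h0 (fun hκ => hpr.trans_le (hκΛ hκ))
    (h := fun t => modelVer κ (dist q (f t)) - modelVer κ t) hcont.continuousOn
    (fun x hx => by
      obtain ⟨s, t, hs, ht, hxs, hxt, h⟩ := hmaj.exists_stewartLE hX hκΛ hfl hf hpr hx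
        (hqf x ⟨hx.1.le, hx.2.le⟩)
      have e := modelSin_mul_modelVer_line (κ := κ) (x - s) s t
      rw [sub_add_cancel] at e
      unfold StewartLE at h
      exact ⟨s, t, hs, ht, hxs, hxt, by linear_combination h - e⟩) hb
  have e := modelSin_mul_modelVer_line (κ := κ) 0 b (L - b)
  simp only [zero_add, add_sub_cancel, modelVer_zero] at e
  simp only [hfs, hft, modelVer_zero] at this
  unfold StewartLE
  rw [add_sub_cancel]
  linear_combination this + e

end Stewart

/-! ### Thin triangles and convex balls -/

section Comparison

/-- Stewart's inequality first bounds d(q, η t) by its model value. Applied again with vertex η t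
and side γ, it bounds d(η t, γ s), since the bound increases with v(d(q, η t)). -/
theorem trianglesThin_of_stewartLE {κ : ℝ} {X : Type*} [MetricSpace X] {M : Type} {δ : M → M → ℝ}
    (hM : IsModelPlane κ M δ)
    (hS : ∀ (p q r : X) (γ : ℝ → X), IsGeodesicBetween γ p r →
      (0 < κ → dist q p + dist q r + dist p r < 2 * (Real.pi / √κ)) → ∀ b ∈ Set.Icc 0 (dist p r),
      StewartLE κ (dist q p) (dist q r) b (dist p r - b) (dist q (γ b))) :
    TrianglesThin κ X M δ := by
  intro p q r γ η hγ hη hper s hs t ht p' q' r' x' y' hpq hqr hpr hpx hxq hpy hyr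
  have d1 := dist_triangle p q r
  have d2 := dist_triangle q r p
  have d3 := dist_triangle q p r
  have ht1 := hη.dist_source ht
  have ht2 := hη.dist_target ht
  have hs1 := hγ.dist_source hs
  have hs2 := hγ.dist_target hs
  have tm := hM.triangle
  rcases (dist_nonneg (x := p) (y := r)).eq_or_lt with h0 | h0
  · have t0 : t = 0 := le_antisymm (ht.2.trans h0.ge) ht.1
    have := tm p' y' x'
    rw [t0, hη.source, dist_comm, hs1, ← hpx, hM.symm x' y']
    linarith
  rcases (dist_nonneg (x := p) (y := q)).eq_or_lt with h1 | h1
  · have s0 : s = 0 := le_antisymm (hs.2.trans h1.ge) hs.1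
    have := tm p' x' y'
    rw [s0, hγ.source, ht1, ← hpy]
    linarith
  rw [dist_comm r p] at hper d2
  rw [dist_comm q p] at d2 d3
  have brp : BelowDiam κ (dist p r) := fun hκ => by linarith [hper hκ]
  have bpq : BelowDiam κ (dist p q) := fun hκ => by linarith [hper hκ]
  have e1 : modelVer κ (dist q (η t)) ≤ modelVer κ (δ q' y') := by
    have i1 := hS p q r η hη (fun hκ => by rw [dist_comm q p]; linarith [hper hκ]) t ht
    have i2 := hM.stewart p' r' q' y' t (dist p r - t) hpy hyr (by rw [hpr]; ring)
    unfold StewartLE at i1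
    rw [hM.symm q' p', hpq, hqr, dist_comm p q, ← add_sub_assoc, add_sub_cancel_left] at i2
    rw [← add_sub_assoc, add_sub_cancel_left] at i1
    exact le_of_mul_le_mul_left (i1.trans i2.ge) (modelSin_pos h0 brp)
  have d4 := dist_triangle (η t) r q
  have d5 := dist_triangle_left (η t) q p
  have d6 := dist_triangle_left p q (η t)
  rw [dist_comm r q] at d4
  have d7 := dist_triangle_left (γ s) (η t) p
  have d8 := dist_triangle_right (γ s) (η t) q
  rw [dist_comm (η t) p] at d6
  have e2 : modelVer κ (dist (η t) (γ s)) ≤ modelVer κ (δ y' x') := by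
    have i1 := hS p (η t) q γ hγ
      (fun hκ => by rw [dist_comm (η t) p]; linarith [hper hκ, ht.1, ht.2]) s hs
    have i2 := hM.stewart p' q' y' x' s (dist p q - s) hpx hxq (by rw [hpq]; ring)
    unfold StewartLE at i1
    rw [dist_comm (η t) p, ht1, dist_comm (η t) q] at i1
    rw [hM.symm y' p', hpy, hM.symm y' q', ← add_sub_assoc, add_sub_cancel_left] at i2
    rw [← add_sub_assoc, add_sub_cancel_left] at i1
    have i3 := mul_le_mul_of_nonneg_left e1 (modelSin_nonneg hs.1 (bpq.mono hs.2).within)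
    exact le_of_mul_le_mul_left (by linarith) (modelSin_pos h1 bpq)
  rw [dist_comm, hM.symm]
  refine le_of_modelVer_le (hM.nonneg _ _) (fun hκ => ?_) e2
  have := hper hκ
  rw [dist_comm (η t) (γ s)]
  rw [dist_comm q (η t)] at *
  linarith

theorem isLengthSpace_of_exists_geodesic {X : Type*} [MetricSpace X]
    (h : ∀ p q : X, ∃ γ : ℝ → X, IsGeodesicBetween γ p q) : IsLengthSpace X := by
  intro p q
  refine le_antisymm (le_iInf fun γ => ?_) ?_
  · simpa using eVariationOn.edist_le γ (s := Set.univ) (Set.mem_univ 0) (Set.mem_univ 1)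
  · obtain ⟨γ, hγ⟩ := h p q
    obtain ⟨f, hfl, hf, -⟩ := hγ.exists_lipschitz
    let c : Path p q :=
      { toFun := fun t => f (dist p q * t)
        continuous_toFun := hfl.continuous.comp (by fun_prop)
        source' := by simp [hf.source]
        target' := by simp [hf.target] }
    refine (iInf_le _ c).trans ?_
    refine (eVariationOn.comp_le_of_monotoneOn f (s := Set.Icc 0 (dist p q))
      (fun t : unitInterval => dist p q * (t : ℝ)) (fun s _ t _ hst => ?_) fun t _ => ?_).trans ?_
    · exact mul_le_mul_of_nonneg_left hst dist_nonneg
    · exact ⟨mul_nonneg dist_nonneg t.2.1, mul_le_of_le_one_right dist_nonneg t.2.2⟩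
    · simpa [edist_dist] using
        eVariationOn_Icc_le_of_lipschitzOnWith (hfl.lipschitzOnWith (s := Set.Icc 0 (dist p q)))

theorem IsGeodesicBetween.coe {X : Type*} [MetricSpace X] {B : Set X} {p q : B} {γ : ℝ → B}
    (h : IsGeodesicBetween γ p q) : IsGeodesicBetween (fun t => (γ t : X)) (p : X) q where
  source := congrArg Subtype.val h.source
  target := congrArg Subtype.val h.target
  isometric := h.isometric

theorem IsGeodesicallyConvex.exists_geodesic {X : Type*} [MetricSpace X] {B : Set X}
    (h : IsGeodesicallyConvex B) (p q : B) : ∃ γ : ℝ → B, IsGeodesicBetween γ p q := by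
  obtain ⟨⟨γ, hγ⟩, hB⟩ := h p p.2 q q.2
  have h0 : (0 : ℝ) ≤ dist (p : X) q := dist_nonneg
  refine ⟨fun t => ⟨γ (Set.projIcc 0 _ h0 t), hB γ hγ (Subtype.prop _)⟩, ?_⟩
  have hval : ∀ t ∈ Set.Icc 0 (dist (p : X) q), γ (Set.projIcc 0 _ h0 t) = γ t := fun t ht => by
    rw [Set.projIcc_of_mem h0 ht]
  refine ⟨Subtype.ext ?_, Subtype.ext ?_, fun s hs t ht => ?_⟩
  · exact (hval 0 ⟨le_rfl, h0⟩).trans hγ.source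
  · exact (hval _ ⟨h0, le_rfl⟩).trans hγ.target
  · have := hγ.isometric s hs t ht
    rw [← hval s hs, ← hval t ht] at this
    exact this

variable {X : Type u} [MetricSpace X] {κ Λ : ℝ}

/-- Bounding both endpoint distances by r in Stewart's inequality with vertex x leaves S(d(p, q))
(v(r) - v(d(x, γ t))) at least C(r) times a nonnegative quantity, and C(r) > 0 because 2r < Λ. -/
theorem MajorizedByCAT.isGeodesicallyConvex_closedBall [CompleteSpace X] (hX : IsLengthSpace X)
    (hmaj : MajorizedByCAT.{u, v} κ Λ X) (hκΛ : 0 < κ → Λ ≤ Real.pi / √κ) (x : X) {r : ℝ}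
    (hr : r < Λ / 2) : IsGeodesicallyConvex (Metric.closedBall x r) := by
  intro p hp q hq
  rw [Metric.mem_closedBall'] at hp hq
  have hr0 : 0 ≤ r := dist_nonneg.trans hp
  have hpq : dist p q ≤ 2 * r := by linarith [dist_triangle_left p q x]
  refine ⟨hmaj.exists_geodesic hX hκΛ (by linarith), fun γ hγ t ht => ?_⟩
  rw [Metric.mem_closedBall']
  rcases (dist_nonneg (x := p) (y := q)).eq_or_lt with h0 | h0
  · have t0 : t = 0 := le_antisymm (ht.2.trans h0.ge) ht.1
    rwa [t0, hγ.source]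
  have hdist : ∀ s ∈ Set.Icc 0 (dist p q), dist x (γ s) < Λ := by
    intro s hs
    have e1 := hγ.dist_source hs
    have e2 := hγ.dist_target hs
    linarith [dist_triangle x p (γ s), dist_triangle_right x (γ s) q]
  have h := hmaj.stewartLE hX hκΛ hγ (by linarith) hdist ht
  have hwithin : ∀ {y}, y < Λ → BelowDiam κ y := fun hy hκ => hy.trans_le (hκΛ hκ)
  have hS := modelSin_pos h0 (hwithin (by linarith : dist p q < Λ))
  have hs := modelSin_nonneg ht.1 (hwithin (by linarith [ht.2] : t < Λ)).within
  have ht' := modelSin_nonneg (sub_nonneg.2 ht.2)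
    (hwithin (by linarith [ht.1] : dist p q - t < Λ)).within
  have vp := mul_le_mul_of_nonneg_left
    (modelVer_le dist_nonneg hp (hwithin (by linarith : r < Λ)).within) ht'
  have vq := mul_le_mul_of_nonneg_left
    (modelVer_le dist_nonneg hq (hwithin (by linarith : r < Λ)).within) hs
  have hcos := modelCos_pos (κ := κ) (t := r) (hwithin (by rw [abs_of_nonneg hr0]; linarith))
  have hpos : 0 ≤ modelCos κ r * (modelSin κ t * modelVer κ (dist p q - t)
      + modelSin κ (dist p q - t) * modelVer κ t) := by
    have := modelVer_nonneg (κ := κ) t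
    have := modelVer_nonneg (κ := κ) (dist p q - t)
    positivity
  have hadd := modelSin_add_eq (κ := κ) t (dist p q - t)
  unfold StewartLE at h
  rw [add_sub_cancel] at h hadd
  rw [modelCos_eq] at hpos
  refine le_of_modelVer_le hr0 (hwithin (hdist t ht)).within (le_of_mul_le_mul_left ?_ hS)
  linear_combination h + vp + vq + hpos - modelVer κ r * hadd

theorem MajorizedByCAT.isCAT_closedBall [CompleteSpace X] (hX : IsLengthSpace X)
    (hmaj : MajorizedByCAT.{u, v} κ Λ X) (hκΛ : 0 < κ → Λ ≤ Real.pi / √κ) (x : X) {r : ℝ}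
    (hr : r < Λ / 2) : IsCAT κ (Metric.closedBall x r) := by
  have hconv := hmaj.isGeodesicallyConvex_closedBall hX hκΛ x hr
  have hlt : ∀ p q : Metric.closedBall x r, dist p q < Λ := fun p q => by
    have hp := Metric.mem_closedBall.1 p.2
    have hq := Metric.mem_closedBall.1 q.2
    rw [Subtype.dist_eq]
    linarith [dist_triangle_right (p : X) q x]
  refine isCAT_of_modelPlane Metric.isClosed_closedBall.isComplete.completeSpace_coe
    (isLengthSpace_of_exists_geodesic hconv.exists_geodesic)
    (fun p q _ => hconv.exists_geodesic p q) fun M δ hM => trianglesThin_of_stewartLE hM ?_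
  intro p q r γ hγ _ b hb
  exact hmaj.stewartLE hX hκΛ hγ.coe (hlt p r) (fun t _ => hlt q (γ t)) hb

/-- For Λ = π/√κ the perimeter condition reads < 2Λ. Twice a side, and twice the distance from a
vertex to a point of the opposite side, are at most the perimeter, so every distance needed for
Stewart's inequality is less than Λ. -/
theorem MajorizedByCAT.isCAT [CompleteSpace X] (hX : IsLengthSpace X)
    (hmaj : MajorizedByCAT.{u, v} κ Λ X) (hκ : 0 < κ) (hΛ : Λ = Real.pi / √κ) : IsCAT κ X := by
  have hκΛ : 0 < κ → Λ ≤ Real.pi / √κ := fun _ => hΛ.le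
  refine isCAT_of_modelPlane inferInstance hX
    (fun p q h => hmaj.exists_geodesic hX hκΛ (hΛ ▸ h hκ)) fun M δ hM =>
      trianglesThin_of_stewartLE hM ?_
  intro p q r γ hγ hper b hb
  have hp := hper hκ
  rw [← hΛ] at hp
  refine hmaj.stewartLE hX hκΛ hγ ?_ (fun t ht => ?_) hb
  · linarith [dist_triangle_left p r q]
  · have e1 := hγ.dist_source ht
    have e2 := hγ.dist_target ht
    linarith [dist_triangle q p (γ t), dist_triangle_right q (γ t) r]

end Comparison

theorem mainTheorem9 (κ Λ : ℝ) (hΛ : 0 < Λ) (hκΛ : 0 < κ → Λ ≤ Real.pi / √κ)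
    (X : Type u) [MetricSpace X] [CompleteSpace X] (hX : IsLengthSpace X)
    (hmaj : ∀ Γ : Set X, IsJordanCurve Γ → jordanLength Γ < ENNReal.ofReal (2 * Λ) →
      ∃ (Y : Type v) (_ : MetricSpace Y), IsCAT κ Y ∧ Majorizes Y Γ) :
    (∀ (x : X) (r : ℝ), r < Λ / 2 →
      IsGeodesicallyConvex (Metric.closedBall x r) ∧ IsCAT κ (Metric.closedBall x r)) ∧
    (0 < κ → Λ = Real.pi / √κ → IsCAT κ X) := by
  have hmaj' : MajorizedByCAT.{u, v} κ Λ X := hmaj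
  exact ⟨fun x r hr => ⟨hmaj'.isGeodesicallyConvex_closedBall hX hκΛ x hr,
    hmaj'.isCAT_closedBall hX hκΛ x hr⟩, fun hκ h => hmaj'.isCAT hX hκ h⟩
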